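/- For $X\in M_n(\mathbb C)$ let $|X|=(X^*X)^{1/2}$, and let $\lambda_1(X),\dots,\lambda_n(X)$ be the eigenvalues of $X$, counted with algebraic multiplicity and ordered so that $|\lambda_1(X)|\ge\cdots\ge|\lambda_n(X)|$. The hyperbolic component of $A\in M_n(\mathbb C)$ is the matrix $H$ that acts as multiplication by $|\mu|$ on the generalized eigenspace of $A$ for each eigenvalue $\mu$; that is, $H=M_0\big(\bigoplus_i|\mu_i|I_{n_i}\big)M_0^{-1}$ whenever $A=M_0\big(\bigoplus_i J_A(\mu_i)\big)M_0^{-1}$ is a Jordan canonical form of $A$ ($\mu_i$ the distinct eigenvalues, $n_i$ their algebraic multiplicities). Put $D=\operatorname{diag}(|\lambda_1(A)|,\dots,|\lambda_n(A)|)$. (a) Let $A\in M_n(\mathbb C)$. There is $M\in GL_n(\mathbb C)$ with $H=MDM^{-1}$, and for all $M,C\in GL_n(\mathbb C)$ there are a lower triangular $L$ and a unitary $Q$ with $M^{-1}C=LQ$. For all $B,C,M\in GL_n(\mathbb C)$ with $H=MDM^{-1}$, and all lower triangular $L$ and unitary $Q$ with $M^{-1}C=LQ$, $$\lim_{m\to\infty}|BA^mC|^{1/m}=Q^*DQ,$$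 and this limit depends only on $A$ and $C$; it does not depend on $B$ or on the choice of $M$, $L$ and $Q$. (b) Let $A\in M_n(\mathbb R)$. Then the same statement holds over $\mathbb R$: there is $M\in GL_n(\mathbb R)$ with $H=MDM^{-1}$, and for all $M,C\in GL_n(\mathbb R)$ there are a real lower triangular $L$ and a real orthogonal $Q$ with $M^{-1}C=LQ$. For all $B,C,M\in GL_n(\mathbb R)$ with $H=MDM^{-1}$ and all such $L$ and $Q$, $\lim_{m\to\infty}|BA^mC|^{1/m}=Q^{T}DQ$ in $M_n(\mathbb R)$, and this limit depends only on $A$ and $C$. (c) (Nayak's theorem, the case $B=C=I$.) Let $A\in M_n(\mathbb C)$, let $\gamma_1>\cdots>\gamma_s\ge0$ be the distinct moduli of the eigenvalues of $A$, and let $A=S+N$ with $S$ diagonalizable, $N$ nilpotent and $SN=NS$. For $1\le j\le s$ let $E_j$ be the orthogonal projection onto the span of the eigenvectors of $S$ for eigenvalues of modulus at most $\gamma_j$, and let $E_{s+1}=0$. Then: (i) $|A^m|^{1/m}$ converges to the positive semidefinite matrix $\sum_{j=1}^s\gamma_j(E_j-E_{j+1})$ as $m\to\infty$. (ii) For $1\le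 j\le s$, a nonzero $x\in\mathbb C^n$ lies in $\operatorname{Im}E_j\setminus\operatorname{Im}E_{j+1}$ if and only if $\lim_{m\to\infty}\|A^mx\|^{1/m}=\gamma_j$, where $\|\cdot\|$ is the Euclidean norm. (iii) For $1\le j\le s$ and every $k\in\mathbb N$, $A^k$ maps $\operatorname{Im}E_j$ into itself and, if $\gamma_j>0$, also maps $\operatorname{Im}E_j\setminus\operatorname{Im}E_{j+1}$ into itself. -/

import Mathlib

open Filter Topology
open scoped MatrixOrder ComplexOrder

noncomputable section

namespace MatrixPowers

variable {n : ℕ}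

/-! ### Eigenvalue moduli -/

theorem length_sort_moduli (A : Matrix (Fin n) (Fin n) ℂ) :
    ((A.charpoly.roots.map (fun z => ‖z‖)).sort (· ≥ ·)).length = n := by
  have h := IsAlgClosed.card_roots_eq_natDegree (p := A.charpoly)
  rw [Multiset.length_sort, Multiset.card_map, h, Matrix.charpoly_natDegree_eq_dim,
    Fintype.card_fin]

/-- The moduli `|λ₁(A)| ≥ ⋯ ≥ |λₙ(A)|` of the eigenvalues of `A`, counted with algebraic
multiplicity and sorted in non-increasing order. -/
def eigenvalueModuli (A : Matrix (Fin n) (Fin n) ℂ) (i : Fin n) : ℝ :=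
  ((A.charpoly.roots.map (fun z => ‖z‖)).sort (· ≥ ·)).get
    (i.cast (length_sort_moduli A).symm)

theorem eigenvalueModuli_antitone (A : Matrix (Fin n) (Fin n) ℂ) :
    Antitone (eigenvalueModuli A) := by
  intro i j hij
  have h := (Multiset.pairwise_sort (A.charpoly.roots.map (fun z => ‖z‖)) (· ≥ ·)).sortedGE
  exact h.antitone_get (by simpa using hij)

theorem map_eigenvalueModuli (A : Matrix (Fin n) (Fin n) ℂ) :
    (Finset.univ.val.map (eigenvalueModuli A)) = A.charpoly.roots.map (fun z => ‖z‖) := by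
  have h1 : List.ofFn (eigenvalueModuli A) =
      (A.charpoly.roots.map (fun z => ‖z‖)).sort (· ≥ ·) := by
    apply List.ext_get
    · rw [List.length_ofFn, length_sort_moduli]
    · intro k h1 h2
      simp [eigenvalueModuli]
  rw [Fin.univ_val_map, h1, Multiset.sort_eq]

/-- The real matrix `D = diag(|λ₁(A)|, …, |λₙ(A)|)`. -/
def moduliMatrix (A : Matrix (Fin n) (Fin n) ℂ) : Matrix (Fin n) (Fin n) ℝ :=
  Matrix.diagonal (eigenvalueModuli A)

/-- A real matrix regarded as a complex one. -/
def toComplex (A : Matrix (Fin n) (Fin n) ℝ) : Matrix (Fin n) (Fin n) ℂ :=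
  A.map (fun x : ℝ => (x : ℂ))

/-- `|X|^{1/m}`, where `|X| = (X* X)^{1/2}`. -/
def absRoot {𝕜 : Type*} [RCLike 𝕜] (X : Matrix (Fin n) (Fin n) 𝕜) (m : ℕ) :
    Matrix (Fin n) (Fin n) 𝕜 :=
  CFC.abs X ^ (1 / (m : ℝ))

/-! ### The hyperbolic component -/

/-- The generalized eigenspace of `A` for the number `μ`. -/
def genEigenspace (A : Matrix (Fin n) (Fin n) ℂ) (μ : ℂ) : Submodule ℂ (Fin n → ℂ) :=
  Module.End.maxGenEigenspace (Matrix.toLin' A) μ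

theorem isCompl_genEigenspace (A : Matrix (Fin n) (Fin n) ℂ) (μ : ℂ) :
    IsCompl (genEigenspace A μ) (⨆ ν, ⨆ (_ : ν ≠ μ), genEigenspace A ν) := by
  refine ⟨Module.End.independent_maxGenEigenspace (Matrix.toLin' A) μ, ?_⟩
  rw [codisjoint_iff, eq_top_iff,
    ← Module.End.iSup_maxGenEigenspace_eq_top (Matrix.toLin' A)]
  refine iSup_le fun ν => ?_
  by_cases h : ν = μ
  · subst h
    exact le_sup_left
  · exact (le_iSup₂_of_le (f := fun κ (_ : κ ≠ μ) => genEigenspace A κ) ν h le_rfl).trans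
      le_sup_right

/-- The hyperbolic component `H` of `A`: the sum, over the distinct eigenvalues `μ` of `A`, of
`|μ|` times the projection onto the generalized eigenspace of `μ` along the sum of the other
generalized eigenspaces. Equivalently `H = M (⨁ |μᵢ| I) M⁻¹` for a matrix `M` that brings `A` to
Jordan canonical form, see `hyperbolicComponent_eq_of_jordan`. -/
def hyperbolicComponent (A : Matrix (Fin n) (Fin n) ℂ) : Matrix (Fin n) (Fin n) ℂ :=
  LinearMap.toMatrix' (∑ μ ∈ A.charpoly.roots.toFinset,
    ((‖μ‖ : ℝ) : ℂ) • Submodule.projection _ _ (isCompl_genEigenspace A μ))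

/-- `J` is a Jordan matrix: it vanishes off the diagonal and the superdiagonal, the superdiagonal
entries are `0` or `1`, and a `1` only joins two equal diagonal entries. -/
def IsJordanMatrix (J : Matrix (Fin n) (Fin n) ℂ) : Prop :=
  ∀ i j : Fin n, i ≠ j →
    J i j = 0 ∨ ((j : ℕ) = (i : ℕ) + 1 ∧ J i j = 1 ∧ J i i = J j j)

theorem hyperbolicComponent_mulVec (A : Matrix (Fin n) (Fin n) ℂ) (μ : ℂ) (v : Fin n → ℂ)
    (hv : v ∈ genEigenspace A μ) :
    (hyperbolicComponent A).mulVec v = ((‖μ‖ : ℝ) : ℂ) • v := by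
  by_cases hv0 : v = 0
  · subst hv0; simp
  have hμ : μ ∈ A.charpoly.roots.toFinset := by
    have h1 : Module.End.HasEigenvalue (Matrix.toLin' A) μ := by
      have h2 : Module.End.HasUnifEigenvalue (Matrix.toLin' A) μ ⊤ := by
        intro h0
        apply hv0
        have h3 : v ∈ Module.End.genEigenspace (Matrix.toLin' A) μ ⊤ := hv
        rw [h0] at h3
        simpa using h3
      exact h2.lt (by simp)
    have h4 : μ ∈ spectrum ℂ A := by
      rw [← Matrix.spectrum_toLin']
      exact h1.mem_spectrum
    rw [Multiset.mem_toFinset, Polynomial.mem_roots A.charpoly_monic.ne_zero]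
    exact Matrix.mem_spectrum_iff_isRoot_charpoly.1 h4
  rw [hyperbolicComponent, LinearMap.toMatrix'_mulVec, LinearMap.sum_apply,
    Finset.sum_eq_single μ]
  · rw [LinearMap.smul_apply, Submodule.projection_apply_of_mem_left _ hv]
  · intro ν _ hν
    have : v ∈ ⨆ κ, ⨆ (_ : κ ≠ ν), genEigenspace A κ :=
      (le_iSup₂_of_le (f := fun κ (_ : κ ≠ ν) => genEigenspace A κ) μ (Ne.symm hν) le_rfl) hv
    rw [LinearMap.smul_apply, (Submodule.projection_apply_eq_zero_iff _).2 this, smul_zero]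
  · exact fun h => absurd hμ h

theorem hyperbolicComponent_eq_of_jordan (A M J : Matrix (Fin n) (Fin n) ℂ) (hM : IsUnit M)
    (hJ : IsJordanMatrix J) (hA : A = M * J * M⁻¹) :
    hyperbolicComponent A = M * Matrix.diagonal (fun i => ((‖J i i‖ : ℝ) : ℂ)) * M⁻¹ := by
  have hdet : IsUnit M.det := (Matrix.isUnit_iff_isUnit_det M).1 hM
  have hAM : A * M = M * J := by
    rw [hA, Matrix.mul_assoc, Matrix.nonsing_inv_mul _ hdet, Matrix.mul_one]
  have hmem : ∀ (k : ℕ) (i : Fin n), (i : ℕ) = k → M.col i ∈ genEigenspace A (J i i) := by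
    intro k
    induction k using Nat.strong_induction_on with
    | _ k ih =>
    intro i hi
    have hcol : A.mulVec (M.col i) = ∑ j, J j i • M.col j := by
      ext r
      have := congrFun (congrFun hAM r) i
      simpa [Matrix.mul_apply, Matrix.mulVec, dotProduct, mul_comm] using this
    have hstep : (Matrix.toLin' A - algebraMap ℂ _ (J i i)) (M.col i)
        ∈ genEigenspace A (J i i) := by
      have : (Matrix.toLin' A - algebraMap ℂ _ (J i i)) (M.col i)
          = ∑ j ∈ Finset.univ.erase i, J j i • M.col j := by
        rw [LinearMap.sub_apply, Matrix.toLin'_apply, hcol,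
          ← Finset.add_sum_erase _ _ (Finset.mem_univ i)]
        simp
      rw [this]
      refine Submodule.sum_mem _ fun j hj => ?_
      rcases hJ j i (Finset.ne_of_mem_erase hj) with h | ⟨h1, -, h3⟩
      · rw [h, zero_smul]; exact Submodule.zero_mem _
      · refine Submodule.smul_mem _ _ ?_
        rw [← h3]
        exact ih j (by omega) j rfl
    rw [genEigenspace, Module.End.mem_maxGenEigenspace] at hstep ⊢
    obtain ⟨p, hp⟩ := hstep
    refine ⟨p + 1, ?_⟩
    rw [pow_succ, Module.End.mul_apply]
    exact hp
  have hHM : hyperbolicComponent A * M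
      = M * Matrix.diagonal (fun i => ((‖J i i‖ : ℝ) : ℂ)) := by
    ext r i
    have := congrFun (hyperbolicComponent_mulVec A _ _ (hmem i i rfl)) r
    rw [Matrix.mul_diagonal]
    simpa [Matrix.mul_apply, Matrix.mulVec, dotProduct, mul_comm] using this
  rw [← hHM, Matrix.mul_assoc, Matrix.mul_nonsing_inv _ hdet, Matrix.mul_one]

/-! ### Data of Nayak's theorem -/

/-- `S` is similar to a diagonal matrix. -/
def IsDiagonalizable (S : Matrix (Fin n) (Fin n) ℂ) : Prop :=
  ∃ P : Matrix (Fin n) (Fin n) ℂ, IsUnit P ∧ (P⁻¹ * S * P).IsDiag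

/-- The orthogonal projection onto the span of the eigenvectors of `S` that belong to eigenvalues
of modulus at most `t`. -/
def spectralProjection (S : Matrix (Fin n) (Fin n) ℂ) (t : ℝ) : Matrix (Fin n) (Fin n) ℂ :=
  (Matrix.toEuclideanCLM (𝕜 := ℂ) (n := Fin n)).symm
    (Submodule.span ℂ {x : EuclideanSpace ℂ (Fin n) |
      ∃ μ : ℂ, ‖μ‖ ≤ t ∧ Matrix.toEuclideanCLM (𝕜 := ℂ) S x = μ • x}).starProjection

/-- The projections `E₁, …, Eₛ` for the moduli `γ₁, …, γₛ`, followed by `Eₛ₊₁ = 0`; the indices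
are shifted down by one. -/
def nayakProjection {s : ℕ} (S : Matrix (Fin n) (Fin n) ℂ) (γ : Fin s → ℝ) (j : ℕ) :
    Matrix (Fin n) (Fin n) ℂ :=
  if h : j < s then spectralProjection S (γ ⟨j, h⟩) else 0

/-- The column space of `E`. -/
def imageOf (E : Matrix (Fin n) (Fin n) ℂ) : Set (EuclideanSpace ℂ (Fin n)) :=
  Set.range (Matrix.toEuclideanCLM (𝕜 := ℂ) E)

end MatrixPowers

end

open Filter Topology
open scoped MatrixOrder ComplexOrder Matrix

noncomputable section

namespace MatrixPowers

variable {n : ℕ}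

/-! On the generalized eigenspace for `μ ≠ 0` the matrix `A` is `|μ|` times an operator whose only
eigenvalue is `μ/|μ|`; the one for `0` is killed by high powers. Hence `A ^ m = U ^ m * H ^ m` for
large `m`, where all eigenvalues of `U` have modulus 1. By Gelfand's formula `U ^ m` and `U⁻¹ ^ m`
both grow subexponentially.

With `H = M D M⁻¹` and `M⁻¹ C = L Q`, this gives `B A^m C Qᴴ = B U^m M D^m L`. The entries of `D`
decrease and `L` is lower triangular, so `D^m L = K_m D^m`, where `K_m` has entries `L_ij
(d_i/d_j)^m` and is bounded, together with its inverse. Therefore `B A^m C Qᴴ = G_m D^m` with `G_m`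
and `G_m⁻¹` of subexponential growth. For every `r > 1` the matrix `X_m = Q |B A^m C|^{1/m} Qᴴ` then
eventually satisfies `r^{-2m} D^{2m} ≤ X_m^{2m} ≤ r^{2m} D^{2m}`. Roots are operator monotone
(Löwner–Heinz), so `r⁻¹ D ≤ X_m ≤ r D`, and `X_m → D`. This is `tendsto_of_subexpGrowth`, applied in
`tendsto_absRoot`. Independence of the choices is uniqueness of limits.

The real case follows by complexification: `H` is real because conjugation exchanges the generalized
eigenspaces of `μ` and its conjugate, and a complex similarity between real matrices can be made
real.

For Nayak's theorem, the eigenspaces of `S` are the generalized eigenspaces of `A`. In the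
coordinates `M⁻¹ x` the image of `E_j` is therefore given by a final segment of indices. Lower
triangular matrices preserve such segments, so with `M⁻¹ = L Q` the projection `E_j` is diagonal in
the orthonormal coordinates `Q x`, and the sum telescopes to `Qᴴ D Q`. The growth rate of `‖A^m x‖`
is the largest modulus in the support of `M⁻¹ x`, which identifies the layer of `x` and is unchanged
when `x` is replaced by a nonzero `A^k x`. -/

/-! ### Sequences of subexponential growth -/

/-- `u` grows more slowly than every geometric sequence of ratio greater than `1`. -/
def SubexpGrowth {E : Type*} [Norm E] (u : ℕ → E) : Prop :=
  ∀ r : ℝ, 1 < r → ∀ᶠ m : ℕ in atTop, ‖u m‖ ≤ r ^ m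

theorem SubexpGrowth.of_bounded {E : Type*} [Norm E] {u : ℕ → E} (c : ℝ)
    (hu : ∀ m, ‖u m‖ ≤ c) : SubexpGrowth u := by
  intro r hr
  filter_upwards [(tendsto_pow_atTop_atTop_of_one_lt hr).eventually_ge_atTop c] with m hm
  exact (hu m).trans hm

theorem SubexpGrowth.mul {E : Type*} [SeminormedRing E] {u v : ℕ → E} (hu : SubexpGrowth u)
    (hv : SubexpGrowth v) : SubexpGrowth (fun m => u m * v m) := by
  intro r hr
  have h1 : 1 < √r := Real.lt_sqrt_of_sq_lt (by simpa using hr)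
  filter_upwards [hu _ h1, hv _ h1] with m hm hm'
  calc ‖u m * v m‖ ≤ ‖u m‖ * ‖v m‖ := norm_mul_le _ _
    _ ≤ √r ^ m * √r ^ m := mul_le_mul hm hm' (norm_nonneg _) (by positivity)
    _ = r ^ m := by rw [← mul_pow, Real.mul_self_sqrt (by linarith)]

theorem SubexpGrowth.const {E : Type*} [Norm E] (a : E) : SubexpGrowth (fun _ : ℕ => a) :=
  .of_bounded ‖a‖ fun _ => le_rfl

/-- The powers of an element of spectral radius at most `1` grow subexponentially. -/
theorem subexpGrowth_pow_of_spectrum {E : Type*} [NormedRing E] [NormedAlgebra ℂ E]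
    [CompleteSpace E] (a : E) (ha : ∀ z ∈ spectrum ℂ a, ‖z‖ ≤ 1) :
    SubexpGrowth (fun m => a ^ m) := by
  intro r hr
  have hrad : spectralRadius ℂ a ≤ 1 := by
    refine iSup₂_le fun z hz => ?_
    exact_mod_cast ha z hz
  have hlt : spectralRadius ℂ a < ENNReal.ofReal r :=
    hrad.trans_lt (by simpa using hr)
  -- Gelfand's formula.
  have h := (spectrum.pow_norm_pow_one_div_tendsto_nhds_spectralRadius a).eventually_lt_const hlt
  filter_upwards [h, eventually_ge_atTop 1] with m hm hm1
  have h1 : ‖a ^ m‖ ^ (1 / m : ℝ) ≤ r :=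
    ((ENNReal.ofReal_lt_ofReal_iff (by linarith)).1 hm).le
  have hm0 : m ≠ 0 := by omega
  calc ‖a ^ m‖ = (‖a ^ m‖ ^ (1 / m : ℝ)) ^ m := by
        rw [one_div, Real.rpow_inv_natCast_pow (norm_nonneg _) hm0]
    _ ≤ r ^ m := pow_le_pow_left₀ (by positivity) h1 m

/-! ### Roots of absolute values in C⋆-algebras -/

section CStar

variable {𝒜 : Type*} [CStarAlgebra 𝒜] [PartialOrder 𝒜] [StarOrderedRing 𝒜]

/-- Löwner–Heinz: `t ↦ t^{1/k}` is operator monotone because `1/k` lies in `[0, 1]`. Powers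
themselves are not, so only this direction is available. -/
theorem le_of_pow_le_pow_of_nonneg {a b : 𝒜} (ha : 0 ≤ a) (hb : 0 ≤ b) {k : ℕ} (hk : k ≠ 0)
    (h : a ^ k ≤ b ^ k) : a ≤ b := by
  have hroot : ∀ c : 𝒜, 0 ≤ c → (c ^ k) ^ ((k : ℝ)⁻¹) = c := by
    intro c hc
    rw [← CFC.rpow_natCast c k hc,
      CFC.rpow_rpow_of_exponent_nonneg c _ _ (by positivity) (by positivity) hc,
      mul_inv_cancel₀ (by exact_mod_cast hk), CFC.rpow_one c hc]
  have hk1 : (1 : ℝ) ≤ k := by exact_mod_cast Nat.one_le_iff_ne_zero.2 hk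
  have := CFC.rpow_le_rpow (p := (k : ℝ)⁻¹) ⟨by positivity, inv_le_one_of_one_le₀ hk1⟩ h
  rwa [hroot a ha, hroot b hb] at this

theorem star_mul_self_mul_le {g y : 𝒜} {c : ℝ} (hg : ‖g‖ ≤ c) :
    star (g * y) * (g * y) ≤ c ^ 2 • (star y * y) := by
  have h1 : star g * g ≤ algebraMap ℝ 𝒜 (c ^ 2) :=
    CStarAlgebra.star_mul_le_algebraMap_norm_sq.trans
      (algebraMap_mono 𝒜 (pow_le_pow_left₀ (norm_nonneg _) hg 2))
  have h2 := star_left_conjugate_le_conjugate h1 y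
  rw [Algebra.algebraMap_eq_smul_one] at h2
  simpa [mul_assoc] using h2

/-- The bound on `g` controls `x^{2m}` from above by `d^{2m}`. Writing `d^m = g' (g d^m)` and using
the bound on `g'` gives the reverse control, without inverting `d`. Taking `2m`-th roots turns the
factor `(r^m)^2` into `r`. -/
theorem smul_le_of_pow_eq {x d g g' : 𝒜} {r : ℝ} {m : ℕ} (hm : m ≠ 0) (hr : 1 < r) (hd : 0 ≤ d)
    (hx : 0 ≤ x) (hxp : x ^ (2 * m) = star (g * d ^ m) * (g * d ^ m)) (hg : ‖g‖ ≤ r ^ m)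
    (hg' : ‖g'‖ ≤ r ^ m) (hgg : g' * g = 1) : x ≤ r • d ∧ d ≤ r • x := by
  have hr0 : 0 ≤ r := by linarith
  have hdp : star (d ^ m) * d ^ m = d ^ (2 * m) := by
    rw [star_pow, (IsSelfAdjoint.of_nonneg hd).star_eq, ← pow_add, two_mul]
  have hmm : 2 * m ≠ 0 := by omega
  have hrm : (r ^ m) ^ 2 = r ^ (2 * m) := by rw [← pow_mul, mul_comm]
  constructor
  · refine le_of_pow_le_pow_of_nonneg hx (smul_nonneg hr0 hd) hmm ?_
    have := star_mul_self_mul_le (y := d ^ m) hg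
    rwa [← hxp, hdp, hrm, ← smul_pow] at this
  · refine le_of_pow_le_pow_of_nonneg hd (smul_nonneg hr0 hx) hmm ?_
    have := star_mul_self_mul_le (y := g * d ^ m) hg'
    rwa [← mul_assoc g' g, hgg, one_mul, hdp, ← hxp, hrm, ← smul_pow] at this

/-- If `|Gₘ Dᵐ|^{1/m} = Xₘ` and both `Gₘ` and a left inverse of it grow subexponentially, then
`Xₘ` converges to `D`. -/
theorem tendsto_of_subexpGrowth {d : 𝒜} (hd : 0 ≤ d) {x g g' : ℕ → 𝒜} (hx : ∀ m, 0 ≤ x m)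
    (hxp : ∀ᶠ m in atTop, x m ^ (2 * m) = star (g m * d ^ m) * (g m * d ^ m))
    (hgg : ∀ m, g' m * g m = 1) (hg : SubexpGrowth g) (hg' : SubexpGrowth g') :
    Tendsto x atTop (𝓝 d) := by
  have hbound : ∀ r : ℝ, 1 < r → ∀ᶠ m in atTop,
      ‖x m - d‖ ≤ (r - r⁻¹) * ‖d‖ + (1 - r⁻¹) * ‖d‖ := by
    intro r hr
    filter_upwards [hxp, hg r hr, hg' r hr, eventually_ne_atTop 0] with m h1 h2 h3 h4
    obtain ⟨h5, h6⟩ := smul_le_of_pow_eq h4 hr hd (hx m) h1 h2 h3 (hgg m)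
    have hr0 : 0 < r := by linarith
    have hinv : r⁻¹ < 1 := inv_lt_one_of_one_lt₀ hr
    have h7 : r⁻¹ • d ≤ x m := by
      have := smul_le_smul_of_nonneg_left h6 (inv_nonneg.2 hr0.le)
      rwa [inv_smul_smul₀ hr0.ne'] at this
    -- The norm is monotone only on positive elements, so the lower bound `r⁻¹ • d` is subtracted in
    -- place of `d`.
    have h8 : ‖x m - r⁻¹ • d‖ ≤ (r - r⁻¹) * ‖d‖ := by
      have : x m - r⁻¹ • d ≤ (r - r⁻¹) • d := by
        rw [sub_smul]; exact sub_le_sub_right h5 _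
      calc _ ≤ ‖(r - r⁻¹) • d‖ :=
            CStarAlgebra.norm_le_norm_of_nonneg_of_le (sub_nonneg.2 h7) this
        _ = _ := by rw [norm_smul, Real.norm_of_nonneg (by linarith)]
    calc ‖x m - d‖ = ‖(x m - r⁻¹ • d) - (1 - r⁻¹) • d‖ := by
          congr 1; rw [sub_smul, one_smul]; abel
      _ ≤ ‖x m - r⁻¹ • d‖ + ‖(1 - r⁻¹) • d‖ := norm_sub_le _ _
      _ ≤ _ := by
        rw [norm_smul, Real.norm_of_nonneg (by linarith : 0 ≤ 1 - r⁻¹)]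
        linarith
  rw [tendsto_iff_norm_sub_tendsto_zero, Metric.tendsto_atTop']
  simp only [dist_zero_right, norm_norm]
  intro ε hε
  have hlim : Tendsto (fun r : ℝ => (r - r⁻¹) * ‖d‖ + (1 - r⁻¹) * ‖d‖) (𝓝[>] 1) (𝓝 0) := by
    have : ContinuousAt (fun r : ℝ => (r - r⁻¹) * ‖d‖ + (1 - r⁻¹) * ‖d‖) 1 := by
      fun_prop (disch := norm_num)
    have h := this.tendsto
    norm_num at h
    exact h.mono_left nhdsWithin_le_nhds
  obtain ⟨r, hr1, hr2⟩ := ((hlim.eventually_lt_const hε).and self_mem_nhdsWithin).exists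
  obtain ⟨N, hN⟩ := eventually_atTop.1 (hbound r hr2)
  exact ⟨N, fun m hm => (hN m (le_of_lt hm)).trans_lt hr1⟩

end CStar

/-! ### Functions of a matrix that are constant on generalized eigenspaces -/

theorem ext_of_genEigenspace (A : Matrix (Fin n) (Fin n) ℂ) {X Y : Matrix (Fin n) (Fin n) ℂ}
    (h : ∀ μ : ℂ, ∀ v ∈ genEigenspace A μ, X.mulVec v = Y.mulVec v) : X = Y := by
  apply Matrix.toLin'.injective
  have htop : (⊤ : Submodule ℂ (Fin n → ℂ)) ≤
      LinearMap.eqLocus (Matrix.toLin' X) (Matrix.toLin' Y) := by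
    rw [← Module.End.iSup_maxGenEigenspace_eq_top (Matrix.toLin' A)]
    refine iSup_le fun μ v hv => ?_
    simpa using h μ v hv
  exact LinearMap.ext fun v => htop (x := v) trivial

theorem mem_roots_of_mem_genEigenspace (A : Matrix (Fin n) (Fin n) ℂ) {μ : ℂ} {v : Fin n → ℂ}
    (hv : v ∈ genEigenspace A μ) (hv0 : v ≠ 0) : μ ∈ A.charpoly.roots := by
  have h1 : Module.End.HasEigenvalue (Matrix.toLin' A) μ := by
    have h2 : Module.End.HasUnifEigenvalue (Matrix.toLin' A) μ ⊤ := by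
      intro h0
      apply hv0
      have h3 : v ∈ Module.End.genEigenspace (Matrix.toLin' A) μ ⊤ := hv
      rw [h0] at h3
      simpa using h3
    exact h2.lt (by simp)
  have h4 : μ ∈ spectrum ℂ A := by
    rw [← Matrix.spectrum_toLin']
    exact h1.mem_spectrum
  rw [Polynomial.mem_roots A.charpoly_monic.ne_zero]
  exact Matrix.mem_spectrum_iff_isRoot_charpoly.1 h4

/-- The matrix acting as multiplication by `g μ` on the generalized eigenspace of `A` for `μ`. -/
def genEigenspaceScaling (A : Matrix (Fin n) (Fin n) ℂ) (g : ℂ → ℂ) : Matrix (Fin n) (Fin n) ℂ :=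
  LinearMap.toMatrix' (∑ μ ∈ A.charpoly.roots.toFinset,
    g μ • Submodule.projection _ _ (isCompl_genEigenspace A μ))

theorem genEigenspaceScaling_mulVec (A : Matrix (Fin n) (Fin n) ℂ) (g : ℂ → ℂ) {μ : ℂ}
    {v : Fin n → ℂ} (hv : v ∈ genEigenspace A μ) :
    (genEigenspaceScaling A g).mulVec v = g μ • v := by
  by_cases hv0 : v = 0
  · subst hv0; simp
  have hμ : μ ∈ A.charpoly.roots.toFinset :=
    Multiset.mem_toFinset.2 (mem_roots_of_mem_genEigenspace A hv hv0)
  rw [genEigenspaceScaling, LinearMap.toMatrix'_mulVec, LinearMap.sum_apply,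
    Finset.sum_eq_single μ]
  · rw [LinearMap.smul_apply, Submodule.projection_apply_of_mem_left _ hv]
  · intro ν _ hν
    have : v ∈ ⨆ κ, ⨆ (_ : κ ≠ ν), genEigenspace A κ :=
      (le_iSup₂_of_le (f := fun κ (_ : κ ≠ ν) => genEigenspace A κ) μ (Ne.symm hν) le_rfl) hv
    rw [LinearMap.smul_apply, (Submodule.projection_apply_eq_zero_iff _).2 this, smul_zero]
  · exact fun h => absurd hμ h

theorem mulVec_mem_genEigenspace (A : Matrix (Fin n) (Fin n) ℂ) {μ : ℂ}
    {v : Fin n → ℂ} (hv : v ∈ genEigenspace A μ) : A.mulVec v ∈ genEigenspace A μ := by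
  have := Module.End.mapsTo_maxGenEigenspace_of_comm
    (Commute.refl (Matrix.toLin' A)) μ hv
  simpa [genEigenspace] using this

/-- Scaling by the indicator of `μ` is the spectral projection of `A` for `μ`; these projections
decompose vectors into generalized eigenvectors below. -/
theorem genEigenspaceScaling_single_mulVec_mem (A : Matrix (Fin n) (Fin n) ℂ) (μ : ℂ)
    (v : Fin n → ℂ) :
    (genEigenspaceScaling A (fun ν => if ν = μ then 1 else 0)).mulVec v ∈ genEigenspace A μ := by
  have htop : (⊤ : Submodule ℂ (Fin n → ℂ)) ≤ (genEigenspace A μ).comap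
      (Matrix.toLin' (genEigenspaceScaling A (fun ν => if ν = μ then 1 else 0))) := by
    rw [← Module.End.iSup_maxGenEigenspace_eq_top (Matrix.toLin' A)]
    refine iSup_le fun ν w hw => ?_
    rw [Submodule.mem_comap, Matrix.toLin'_apply, genEigenspaceScaling_mulVec A _ hw]
    split_ifs with h
    · subst h; exact Submodule.smul_mem _ _ hw
    · simp
  simpa using htop (x := v) trivial

theorem sum_genEigenspaceScaling_single (A : Matrix (Fin n) (Fin n) ℂ) :
    ∑ μ ∈ A.charpoly.roots.toFinset,
      genEigenspaceScaling A (fun ν => if ν = μ then 1 else 0) = 1 := by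
  refine ext_of_genEigenspace A fun ν w hw => ?_
  rw [Matrix.sum_mulVec, Matrix.one_mulVec,
    Finset.sum_congr rfl fun μ _ => genEigenspaceScaling_mulVec A _ hw]
  by_cases hw0 : w = 0
  · subst hw0; simp
  · rw [Finset.sum_eq_single ν]
    · simp
    · intro μ _ h; simp [h.symm]
    · exact fun h => absurd
        (Multiset.mem_toFinset.2 (mem_roots_of_mem_genEigenspace A hw hw0)) h

/-- The factor of `A` with eigenvalues of modulus `1`: it acts as `|μ|⁻¹ A` on the generalized
eigenspace for `μ ≠ 0` and as the identity on the one for `0`. -/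
def unimodularPart (A : Matrix (Fin n) (Fin n) ℂ) : Matrix (Fin n) (Fin n) ℂ :=
  genEigenspaceScaling A (fun μ => ((‖μ‖⁻¹ : ℝ) : ℂ)) * A +
    genEigenspaceScaling A (fun μ => if μ = 0 then 1 else 0)

theorem unimodularPart_mulVec (A : Matrix (Fin n) (Fin n) ℂ) {μ : ℂ} (hμ : μ ≠ 0)
    {v : Fin n → ℂ} (hv : v ∈ genEigenspace A μ) :
    (unimodularPart A).mulVec v = ((‖μ‖⁻¹ : ℝ) : ℂ) • A.mulVec v := by
  rw [unimodularPart, Matrix.add_mulVec, ← Matrix.mulVec_mulVec,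
    genEigenspaceScaling_mulVec A _ (mulVec_mem_genEigenspace A hv),
    genEigenspaceScaling_mulVec A _ hv, if_neg hμ, zero_smul, add_zero]

theorem unimodularPart_mulVec_zero (A : Matrix (Fin n) (Fin n) ℂ)
    {v : Fin n → ℂ} (hv : v ∈ genEigenspace A 0) :
    (unimodularPart A).mulVec v = v := by
  rw [unimodularPart, Matrix.add_mulVec, ← Matrix.mulVec_mulVec,
    genEigenspaceScaling_mulVec A _ (mulVec_mem_genEigenspace A hv),
    genEigenspaceScaling_mulVec A _ hv]
  simp

/-- On a generalized eigenspace with `μ ≠ 0` the factors `|μ|` and `|μ|⁻¹` cancel. For `μ = 0` both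
sides vanish once `m` is large: `H` is zero there, and `A ^ n` already kills the space. -/
theorem pow_eq_unimodularPart_pow_mul (A : Matrix (Fin n) (Fin n) ℂ) {m : ℕ} (hm : n < m) :
    A ^ m = unimodularPart A ^ m * hyperbolicComponent A ^ m := by
  have hscale : ∀ (X : Matrix (Fin n) (Fin n) ℂ) (c : ℂ) (v : Fin n → ℂ), X.mulVec v = c • v →
      ∀ k : ℕ, (X ^ k).mulVec v = c ^ k • v := by
    intro X c v h k
    induction k with
    | zero => simp
    | succ k ih =>
      rw [pow_succ, ← Matrix.mulVec_mulVec, h, Matrix.mulVec_smul, ih, smul_smul, pow_succ']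
  refine ext_of_genEigenspace A fun μ v hv => ?_
  rw [← Matrix.mulVec_mulVec, hscale _ _ _ (hyperbolicComponent_mulVec A μ v hv),
    Matrix.mulVec_smul]
  rcases eq_or_ne μ 0 with rfl | hμ
  · rw [norm_zero, Complex.ofReal_zero, zero_pow (by omega), zero_smul]
    have h1 : v ∈ LinearMap.ker (Matrix.toLin' A ^ m) := by
      have h2 := Module.End.maxGenEigenspace_eq_genEigenspace_finrank (Matrix.toLin' A) 0
      have h3 : v ∈ Module.End.maxGenEigenspace (Matrix.toLin' A) 0 := hv
      rw [h2, Module.End.mem_genEigenspace_nat] at h3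
      simp only [zero_smul, sub_zero, Module.finrank_fin_fun] at h3
      rw [LinearMap.mem_ker] at h3 ⊢
      rw [← Nat.sub_add_cancel hm.le, pow_add, Module.End.mul_apply, h3, map_zero]
    rwa [LinearMap.mem_ker, ← Matrix.toLin'_pow, Matrix.toLin'_apply] at h1
  · have hpow : ∀ (k : ℕ) (w : Fin n → ℂ), w ∈ genEigenspace A μ →
        ((‖μ‖ : ℝ) : ℂ) ^ k • (unimodularPart A ^ k).mulVec w = (A ^ k).mulVec w := by
      intro k
      induction k with
      | zero => simp
      | succ k ih =>
        intro w hw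
        rw [pow_succ (unimodularPart A), ← Matrix.mulVec_mulVec, unimodularPart_mulVec A hμ hw,
          Matrix.mulVec_smul, smul_smul, pow_succ, mul_assoc, ← Complex.ofReal_mul,
          mul_inv_cancel₀ (norm_ne_zero_iff.2 hμ), Complex.ofReal_one, mul_one,
          ih _ (mulVec_mem_genEigenspace A hw), Matrix.mulVec_mulVec, ← pow_succ]
    exact (hpow m v hv).symm

/-- The spectral projections of `A` commute with `U`, so some component of an eigenvector of `U` is
an eigenvector inside a single generalized eigenspace. For `μ ≠ 0` it is an eigenvector of `A` for
`|μ| z`, and disjointness of generalized eigenspaces forces `|μ| z = μ`. -/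
theorem norm_eq_one_of_mem_spectrum_unimodularPart (A : Matrix (Fin n) (Fin n) ℂ) {z : ℂ}
    (hz : z ∈ spectrum ℂ (unimodularPart A)) : ‖z‖ = 1 := by
  rw [← Matrix.spectrum_toLin', ← Module.End.hasEigenvalue_iff_mem_spectrum] at hz
  obtain ⟨v, hv⟩ := hz.exists_hasEigenvector
  have hvU : (unimodularPart A).mulVec v = z • v := by simpa using hv.apply_eq_smul
  obtain ⟨μ, w, hw, hw0, hwU⟩ : ∃ μ : ℂ, ∃ w ∈ genEigenspace A μ, w ≠ 0 ∧
      (unimodularPart A).mulVec w = z • w := by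
    by_contra! hcon
    apply hv.2
    have hproj : ∀ μ, (genEigenspaceScaling A (fun ν => if ν = μ then 1 else 0)).mulVec v = 0 := by
      intro μ
      by_contra hne
      set E := genEigenspaceScaling A (fun ν => if ν = μ then 1 else 0) with hE
      have hcomm : Commute E (unimodularPart A) := by
        refine ext_of_genEigenspace A fun ν w hw => ?_
        rw [← Matrix.mulVec_mulVec, ← Matrix.mulVec_mulVec, hE, genEigenspaceScaling_mulVec A _ hw,
          Matrix.mulVec_smul]
        rcases eq_or_ne ν 0 with rfl | hν
        · rw [unimodularPart_mulVec_zero A hw, genEigenspaceScaling_mulVec A _ hw]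
        · rw [unimodularPart_mulVec A hν hw, Matrix.mulVec_smul,
            genEigenspaceScaling_mulVec A _ (mulVec_mem_genEigenspace A hw), smul_comm]
      refine hcon μ _ (genEigenspaceScaling_single_mulVec_mem A μ v) hne ?_
      rw [Matrix.mulVec_mulVec, ← hcomm.eq, ← Matrix.mulVec_mulVec, hvU, Matrix.mulVec_smul]
    rw [← Matrix.one_mulVec v, ← sum_genEigenspaceScaling_single A, Matrix.sum_mulVec]
    exact Finset.sum_eq_zero fun μ _ => hproj μ
  rcases eq_or_ne μ 0 with rfl | hμ
  · rw [unimodularPart_mulVec_zero A hw] at hwU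
    have : (z - 1) • w = 0 := by rw [sub_smul, one_smul, ← hwU, sub_self]
    rw [smul_eq_zero, or_iff_left hw0, sub_eq_zero] at this
    simp [this]
  · rw [unimodularPart_mulVec A hμ hw] at hwU
    have hμ0 : ((‖μ‖ : ℝ) : ℂ) ≠ 0 := by simpa using hμ
    have hAw : A.mulVec w = (‖μ‖ * z) • w := by
      rw [mul_smul, ← hwU, smul_smul, Complex.ofReal_inv, mul_inv_cancel₀ hμ0, one_smul]
    have hmem : w ∈ genEigenspace A (‖μ‖ * z) := by
      rw [genEigenspace, Module.End.mem_maxGenEigenspace]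
      exact ⟨1, by simp [hAw]⟩
    have heq : ‖μ‖ * z = μ := by
      by_contra hne
      apply hw0
      have hd := Module.End.disjoint_genEigenspace (Matrix.toLin' A) hne ⊤ ⊤
      exact Submodule.disjoint_def.1 hd w hmem hw
    have := congrArg norm heq
    rw [norm_mul, Complex.norm_real, norm_norm] at this
    exact (mul_eq_left₀ (norm_ne_zero_iff.2 hμ)).1 this

theorem isUnit_unimodularPart (A : Matrix (Fin n) (Fin n) ℂ) : IsUnit (unimodularPart A) := by
  by_contra h
  have := norm_eq_one_of_mem_spectrum_unimodularPart A ((spectrum.zero_mem_iff ℂ).2 h)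
  simp at this

/-! ### Growth of the powers of the unimodular part and of its inverse -/

section Growth

open scoped Matrix.Norms.L2Operator

theorem subexpGrowth_unimodularPart (A : Matrix (Fin n) (Fin n) ℂ) :
    SubexpGrowth (fun m => unimodularPart A ^ m) :=
  subexpGrowth_pow_of_spectrum _ fun _ hz => (norm_eq_one_of_mem_spectrum_unimodularPart A hz).le

theorem subexpGrowth_inv_unimodularPart (A : Matrix (Fin n) (Fin n) ℂ) :
    SubexpGrowth (fun m => (unimodularPart A)⁻¹ ^ m) := by
  refine subexpGrowth_pow_of_spectrum _ fun z hz => ?_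
  obtain ⟨u, hu⟩ := isUnit_unimodularPart A
  rw [← hu, ← Matrix.coe_units_inv] at hz
  have h1 : z ≠ 0 := by
    rintro rfl
    exact (spectrum.zero_mem_iff ℂ).1 hz u⁻¹.isUnit
  have h2 : (Units.mk0 z h1 : ℂˣ).val⁻¹ ∈ spectrum ℂ (unimodularPart A) := by
    rw [← hu]
    have := spectrum.inv_mem_iff (r := Units.mk0 z h1) (a := u⁻¹)
    simpa using this.1 hz
  have := norm_eq_one_of_mem_spectrum_unimodularPart A h2
  rw [Units.val_mk0, norm_inv, inv_eq_one] at this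
  exact this.le

end Growth

/-! ### Diagonal scaling of lower triangular matrices -/

/-- The quotient `dᵢ / dⱼ`, or `1` if `dⱼ = 0`. -/
def scalingRatio (d : Fin n → ℝ) (i j : Fin n) : ℝ :=
  if d j = 0 then 1 else d i / d j

/-- The matrix `K` with `Dᵐ L = K Dᵐ`, for `D = diag(d)` and `L` lower triangular. -/
def diagonalScaling (d : Fin n → ℝ) (L : Matrix (Fin n) (Fin n) ℂ) (m : ℕ) :
    Matrix (Fin n) (Fin n) ℂ :=
  Matrix.of fun i j => L i j * ((scalingRatio d i j : ℝ) : ℂ) ^ m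

/-- The default value `1` is harmless on and below the diagonal: since `d` is nonnegative and
decreasing, a zero entry forces all later entries to be zero. -/
theorem scalingRatio_mul {d : Fin n → ℝ} (hd : Antitone d)
    (hd0 : ∀ i, 0 ≤ d i) {i j k : Fin n} (hij : j ≤ i) (hjk : k ≤ j) :
    scalingRatio d i j * scalingRatio d j k = scalingRatio d i k := by
  have h1 := hd hij
  have h2 := hd hjk
  have h3 := hd0 i
  have h4 := hd0 j
  unfold scalingRatio
  by_cases hk : d k = 0
  · have hj : d j = 0 := by linarith
    simp [hk, hj]
  · by_cases hj : d j = 0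
    · have hi : d i = 0 := by linarith
      simp [hk, hj, hi]
    · rw [if_neg hk, if_neg hj, if_neg hk, div_mul_div_cancel₀ hj]

theorem abs_scalingRatio_le_one {d : Fin n → ℝ} (hd : Antitone d)
    (hd0 : ∀ i, 0 ≤ d i) {i j : Fin n} (hij : j ≤ i) : |scalingRatio d i j| ≤ 1 := by
  have h1 := hd hij
  unfold scalingRatio
  split_ifs with h
  · simp
  · rw [abs_of_nonneg (div_nonneg (hd0 i) (hd0 j))]
    exact div_le_one_of_le₀ h1 (hd0 j)

theorem scalingRatio_self (d : Fin n → ℝ) (i : Fin n) : scalingRatio d i i = 1 := by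
  unfold scalingRatio
  split_ifs with h
  · rfl
  · exact div_self h

theorem diagonalScaling_one (d : Fin n → ℝ) (m : ℕ) : diagonalScaling d 1 m = 1 := by
  ext i j
  rcases eq_or_ne i j with rfl | h
  · simp [diagonalScaling, scalingRatio_self]
  · simp [diagonalScaling, Matrix.one_apply_ne h]

/-- `L ↦ K_m` behaves like conjugation by `D^m` even when `D` is singular. Applied to `L⁻¹` and `L`,
it supplies the inverse of `K_m`. -/
theorem diagonalScaling_mul {d : Fin n → ℝ} (hd : Antitone d)
    (hd0 : ∀ i, 0 ≤ d i) {L L' : Matrix (Fin n) (Fin n) ℂ} (hL : L.IsLowerTriangular)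
    (hL' : L'.IsLowerTriangular) (m : ℕ) :
    diagonalScaling d L m * diagonalScaling d L' m = diagonalScaling d (L * L') m := by
  ext i k
  simp only [diagonalScaling, Matrix.mul_apply, Matrix.of_apply, Finset.sum_mul]
  refine Finset.sum_congr rfl fun j _ => ?_
  by_cases hij : j ≤ i
  · by_cases hjk : k ≤ j
    · rw [← scalingRatio_mul hd hd0 hij hjk]
      push_cast
      ring
    · rw [hL' (i := j) (j := k) (by simpa using hjk)]
      ring
  · rw [hL (i := i) (j := j) (by simpa using hij)]
    ring

theorem diagonal_pow_mul_eq {d : Fin n → ℝ} (hd : Antitone d)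
    (hd0 : ∀ i, 0 ≤ d i) {L : Matrix (Fin n) (Fin n) ℂ} (hL : L.IsLowerTriangular) {m : ℕ}
    (hm : m ≠ 0) :
    Matrix.diagonal (fun i => (d i : ℂ)) ^ m * L =
      diagonalScaling d L m * Matrix.diagonal (fun i => (d i : ℂ)) ^ m := by
  ext i j
  rw [Matrix.diagonal_pow, Matrix.diagonal_mul, Matrix.mul_diagonal]
  simp only [diagonalScaling, Matrix.of_apply, Pi.pow_apply]
  by_cases hij : j ≤ i
  · have h1 := hd hij
    have h3 := hd0 i
    unfold scalingRatio
    -- Here `d i` vanishes too, and both sides are zero because `m ≠ 0`.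
    by_cases hj : d j = 0
    · have hi : d i = 0 := by linarith
      simp [hi, hj, hm]
    · have hj' : (d j : ℂ) ≠ 0 := by exact_mod_cast hj
      rw [if_neg hj]
      push_cast
      rw [div_pow]
      field_simp
  · rw [hL (i := i) (j := j) (by simpa using hij)]
    ring

-- All the ratios that meet a nonzero entry of `L` are at most 1 in absolute value, so the sequence
-- is bounded.
open scoped Matrix.Norms.L2Operator in
theorem subexpGrowth_diagonalScaling {d : Fin n → ℝ} (hd : Antitone d)
    (hd0 : ∀ i, 0 ≤ d i) {L : Matrix (Fin n) (Fin n) ℂ} (hL : L.IsLowerTriangular) :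
    SubexpGrowth (diagonalScaling d L) := by
  refine .of_bounded (∑ i, ∑ j, ‖L i j‖ * ‖Matrix.single i j (1 : ℂ)‖) fun m => ?_
  rw [Matrix.matrix_eq_sum_single (diagonalScaling d L m)]
  refine (norm_sum_le _ _).trans (Finset.sum_le_sum fun i _ => (norm_sum_le _ _).trans
    (Finset.sum_le_sum fun j _ => ?_))
  rw [← mul_one (diagonalScaling d L m i j), ← smul_eq_mul, ← Matrix.smul_single, norm_smul]
  refine mul_le_mul_of_nonneg_right ?_ (norm_nonneg _)
  by_cases hij : j ≤ i
  · rw [diagonalScaling, Matrix.of_apply, norm_mul, norm_pow, Complex.norm_real]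
    exact mul_le_of_le_one_right (norm_nonneg _)
      (pow_le_one₀ (norm_nonneg _) (abs_scalingRatio_le_one hd hd0 hij))
  · rw [diagonalScaling, Matrix.of_apply, hL (i := i) (j := j) (by simpa using hij)]
    simp

theorem IsLowerTriangular.inv {𝕜 : Type*} [Field 𝕜] {L : Matrix (Fin n) (Fin n) 𝕜} (hL : L.IsLowerTriangular)
    (hu : IsUnit L) : L⁻¹.IsLowerTriangular := by
  have := hu.invertible
  exact Matrix.blockTriangular_inv_of_blockTriangular hL

/-! ### The limit for complex matrices -/

theorem eigenvalueModuli_nonneg (A : Matrix (Fin n) (Fin n) ℂ) (i : Fin n) :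
    0 ≤ eigenvalueModuli A i := by
  have h : eigenvalueModuli A i ∈ A.charpoly.roots.map (fun z => ‖z‖) := by
    rw [← map_eigenvalueModuli]
    exact Multiset.mem_map_of_mem _ (Finset.mem_univ i)
  obtain ⟨z, -, hz⟩ := Multiset.mem_map.1 h
  exact hz ▸ norm_nonneg z

theorem toComplex_moduliMatrix (A : Matrix (Fin n) (Fin n) ℂ) :
    toComplex (moduliMatrix A) = Matrix.diagonal (fun i => (eigenvalueModuli A i : ℂ)) := by
  rw [toComplex, moduliMatrix, Matrix.diagonal_map (by simp)]

theorem moduliMatrix_posSemidef (A : Matrix (Fin n) (Fin n) ℂ) :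
    (toComplex (moduliMatrix A)).PosSemidef := by
  rw [toComplex_moduliMatrix]
  exact Matrix.PosSemidef.diagonal fun i => by
    simpa using eigenvalueModuli_nonneg A i

theorem absRoot_nonneg {𝕜 : Type*} [RCLike 𝕜] (X : Matrix (Fin n) (Fin n) 𝕜) (m : ℕ) :
    0 ≤ absRoot X m :=
  CFC.rpow_nonneg

/-- The exponent `2 * m` removes both roots at once; `|X|^{1/m}` is used below only as the positive
`2m`-th root of `Xᴴ X`. -/
theorem absRoot_pow {𝕜 : Type*} [RCLike 𝕜] (X : Matrix (Fin n) (Fin n) 𝕜) {m : ℕ} (hm : m ≠ 0) :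
    absRoot X m ^ (2 * m) = Xᴴ * X := by
  have h1 : absRoot X m ^ m = CFC.abs X := by
    rw [absRoot, ← CFC.rpow_natCast _ m CFC.rpow_nonneg,
      CFC.rpow_rpow_of_exponent_nonneg _ _ _ (by positivity) (by positivity) (CFC.abs_nonneg X),
      one_div, inv_mul_cancel₀ (by exact_mod_cast hm), CFC.rpow_one _ (CFC.abs_nonneg X)]
  rw [mul_comm, pow_mul, h1, sq, CFC.abs_mul_abs, Matrix.star_eq_conjTranspose]

theorem pow_eq_of_hyperbolicComponent_eq {A M : Matrix (Fin n) (Fin n) ℂ} (hM : IsUnit M)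
    (hH : hyperbolicComponent A = M * toComplex (moduliMatrix A) * M⁻¹) {m : ℕ} (hm : n < m) :
    A ^ m = unimodularPart A ^ m * (M * toComplex (moduliMatrix A) ^ m * M⁻¹) := by
  rw [pow_eq_unimodularPart_pow_mul A hm, hH]
  obtain ⟨u, rfl⟩ := hM
  rw [← Matrix.coe_units_inv, Units.conj_pow]

open scoped Matrix.Norms.L2Operator in
theorem tendsto_of_pow_eq {d : Matrix (Fin n) (Fin n) ℂ} (hd : 0 ≤ d)
    {x g g' : ℕ → Matrix (Fin n) (Fin n) ℂ} (hx : ∀ m, 0 ≤ x m)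
    (hxp : ∀ᶠ m in atTop, x m ^ (2 * m) = star (g m * d ^ m) * (g m * d ^ m))
    (hgg : ∀ m, g' m * g m = 1) (hg : SubexpGrowth g) (hg' : SubexpGrowth g') :
    Tendsto x atTop (𝓝 d) :=
  tendsto_of_subexpGrowth hd hx hxp hgg hg hg'

open scoped Matrix.Norms.L2Operator in
theorem tendsto_absRoot {A B C M L Q : Matrix (Fin n) (Fin n) ℂ} (hB : IsUnit B) (hC : IsUnit C)
    (hM : IsUnit M) (hH : hyperbolicComponent A = M * toComplex (moduliMatrix A) * M⁻¹)
    (hL : L.IsLowerTriangular) (hQ : Q ∈ Matrix.unitaryGroup (Fin n) ℂ) (hMC : M⁻¹ * C = L * Q) :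
    Tendsto (fun m : ℕ => absRoot (B * A ^ m * C) m) atTop
      (𝓝 (Qᴴ * toComplex (moduliMatrix A) * Q)) := by
  have hQ1 : Qᴴ * Q = 1 := Matrix.mem_unitaryGroup_iff'.1 hQ
  have hQ2 : Q * Qᴴ = 1 := Matrix.mem_unitaryGroup_iff.1 hQ
  set d := eigenvalueModuli A with hd
  have hanti : Antitone d := eigenvalueModuli_antitone A
  have hnn : ∀ i, 0 ≤ d i := eigenvalueModuli_nonneg A
  set D := toComplex (moduliMatrix A) with hD
  have hDd : D = Matrix.diagonal (fun i => (d i : ℂ)) := toComplex_moduliMatrix A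
  have hLunit : IsUnit L := by
    have h1 : L = M⁻¹ * C * Qᴴ := by rw [hMC, mul_assoc, hQ2, mul_one]
    rw [h1]
    exact ((Matrix.isUnit_nonsing_inv_iff.2 hM).mul hC).mul
      (IsUnit.of_mul_eq_one _ hQ1)
  have hinv : ∀ {X : Matrix (Fin n) (Fin n) ℂ}, IsUnit X → X⁻¹ * X = 1 := fun h =>
    Matrix.nonsing_inv_mul _ ((Matrix.isUnit_iff_isUnit_det _).1 h)
  have hLinv := IsLowerTriangular.inv hL hLunit
  set U := unimodularPart A with hU
  have hUunit : IsUnit U := isUnit_unimodularPart A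
  -- Conjugation by the unitary `Q` commutes with powers and replaces `B A^m C` by `B A^m C Qᴴ`,
  -- which has the form `g m * D ^ m`.
  have key : Tendsto (fun m : ℕ => Q * absRoot (B * A ^ m * C) m * Qᴴ) atTop (𝓝 D) := by
    refine tendsto_of_pow_eq (moduliMatrix_posSemidef A).nonneg
      (g := fun m => B * U ^ m * M * diagonalScaling d L m)
      (g' := fun m => diagonalScaling d L⁻¹ m * M⁻¹ * U⁻¹ ^ m * B⁻¹) ?_ ?_ ?_ ?_ ?_
    · intro m
      have := star_right_conjugate_nonneg (absRoot_nonneg (B * A ^ m * C) m) Q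
      exact this
    · filter_upwards [eventually_gt_atTop n] with m hm
      have hm0 : m ≠ 0 := by omega
      have h1 : B * A ^ m * C * Qᴴ = B * U ^ m * M * diagonalScaling d L m * D ^ m := by
        have hDL : D ^ m * L = diagonalScaling d L m * D ^ m := by
          rw [hDd]; exact diagonal_pow_mul_eq hanti hnn hL hm0
        calc B * A ^ m * C * Qᴴ = B * U ^ m * M * (D ^ m * (M⁻¹ * C) * Qᴴ) := by
              rw [pow_eq_of_hyperbolicComponent_eq hM hH hm]; simp only [mul_assoc]; rfl
          _ = B * U ^ m * M * (D ^ m * L) := by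
              rw [hMC, mul_assoc (D ^ m), mul_assoc L, hQ2, mul_one]
          _ = _ := by rw [hDL]; simp only [mul_assoc]
      rw [← h1]
      have h2 : (Q * absRoot (B * A ^ m * C) m * Qᴴ) ^ (2 * m) =
          Q * absRoot (B * A ^ m * C) m ^ (2 * m) * Qᴴ :=
        Units.conj_pow ⟨Q, Qᴴ, hQ2, hQ1⟩ _ _
      rw [h2, absRoot_pow _ hm0, Matrix.star_eq_conjTranspose, Matrix.conjTranspose_mul _ Qᴴ,
        Matrix.conjTranspose_conjTranspose]
      simp only [mul_assoc]
    · intro m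
      have h1 : diagonalScaling d L⁻¹ m * diagonalScaling d L m = 1 := by
        rw [diagonalScaling_mul hanti hnn hLinv hL, hinv hLunit, diagonalScaling_one]
      have h2 : U⁻¹ ^ m * U ^ m = 1 := by
        rw [← Commute.mul_pow, hinv hUunit, one_pow]
        rw [Commute, SemiconjBy, hinv hUunit,
          Matrix.mul_nonsing_inv _ ((Matrix.isUnit_iff_isUnit_det _).1 hUunit)]
      calc diagonalScaling d L⁻¹ m * M⁻¹ * U⁻¹ ^ m * B⁻¹ * (B * U ^ m * M * diagonalScaling d L m)
          = diagonalScaling d L⁻¹ m * (M⁻¹ * ((U⁻¹ ^ m * ((B⁻¹ * B) * U ^ m)) * M)) *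
              diagonalScaling d L m := by simp only [mul_assoc]
        _ = 1 := by rw [hinv hB, one_mul, h2, one_mul, hinv hM, mul_one, h1]
    · exact (((SubexpGrowth.const B).mul (subexpGrowth_unimodularPart A)).mul (.const M)).mul
        (subexpGrowth_diagonalScaling hanti hnn hL)
    · exact (((subexpGrowth_diagonalScaling hanti hnn hLinv).mul (.const M⁻¹)).mul
        (subexpGrowth_inv_unimodularPart A)).mul (.const B⁻¹)
  have hcont : Continuous fun X : Matrix (Fin n) (Fin n) ℂ => Qᴴ * X * Q := by fun_prop
  have h := (hcont.tendsto D).comp key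
  refine h.congr fun m => ?_
  simp only [Function.comp_apply]
  calc Qᴴ * (Q * absRoot (B * A ^ m * C) m * Qᴴ) * Q
      = (Qᴴ * Q) * absRoot (B * A ^ m * C) m * (Qᴴ * Q) := by simp only [mul_assoc]
    _ = _ := by rw [hQ1, one_mul, mul_one]

/-! ### Existence of the factorizations -/

/-- Gram–Schmidt on the rows, read off from the LDL decomposition: `K (Y Yᴴ) Kᴴ = diag(e)` with `K`
lower triangular and `e > 0`, so the rows of `diag(√e)⁻¹ K Y` are orthonormal. -/
theorem exists_lowerTriangular_mul_unitary {𝕜 : Type*} [RCLike 𝕜] {Y : Matrix (Fin n) (Fin n) 𝕜}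
    (hY : IsUnit Y) : ∃ L Q : Matrix (Fin n) (Fin n) 𝕜,
      L.IsLowerTriangular ∧ Q ∈ Matrix.unitaryGroup (Fin n) 𝕜 ∧ Y = L * Q := by
  have hS : (Y * Yᴴ).PosDef := by
    refine Matrix.PosDef.mul_conjTranspose_self Y ?_
    exact Matrix.vecMul_injective_of_isUnit hY
  set K := LDL.lowerInv hS with hK
  have hKunit : IsUnit K := isUnit_of_invertible K
  have hKdet := (Matrix.isUnit_iff_isUnit_det _).1 hKunit
  have hKlow : K.IsLowerTriangular := fun i j hij => LDL.lowerInv_triangular hS hij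
  set e := LDL.diagEntries hS with he
  have hZ : Matrix.diagonal e = (K * Y) * (K * Y)ᴴ := by
    have h := LDL.diag_eq_lowerInv_conj hS
    rw [LDL.diag] at h
    rw [he, h, Matrix.conjTranspose_mul]
    simp only [mul_assoc, hK]
  have hpd : (Matrix.diagonal e).PosDef := by
    rw [hZ]
    exact Matrix.PosDef.mul_conjTranspose_self _
      (Matrix.vecMul_injective_of_isUnit (hKunit.mul hY))
  have hpos : ∀ i, 0 < e i := Matrix.posDef_diagonal_iff.1 hpd
  have hre : ∀ i, 0 < RCLike.re (e i) ∧ ((RCLike.re (e i) : ℝ) : 𝕜) = e i := fun i => by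
    obtain ⟨h1, h2⟩ := RCLike.pos_iff.1 (hpos i)
    exact ⟨h1, RCLike.ext (by simp) (by simp [h2])⟩
  set s : Fin n → 𝕜 := fun i => ((√(RCLike.re (e i)) : ℝ) : 𝕜) with hs
  have hs0 : ∀ i, s i ≠ 0 := fun i => by
    simpa [hs] using (Real.sqrt_pos.2 (hre i).1).ne'
  have hss : ∀ i, s i * s i = e i := fun i => by
    rw [hs, ← RCLike.ofReal_mul, Real.mul_self_sqrt (hre i).1.le, (hre i).2]
  have hstar : ∀ i, star (s i) = s i := fun i => by simp [hs]
  refine ⟨K⁻¹ * Matrix.diagonal s, Matrix.diagonal (fun i => (s i)⁻¹) * (K * Y), ?_, ?_, ?_⟩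
  · exact (IsLowerTriangular.inv hKlow hKunit).mul (Matrix.blockTriangular_diagonal s)
  · rw [Matrix.mem_unitaryGroup_iff, Matrix.star_eq_conjTranspose, Matrix.conjTranspose_mul]
    have : Matrix.diagonal (fun i => (s i)⁻¹) * (K * Y) *
        ((K * Y)ᴴ * (Matrix.diagonal fun i => (s i)⁻¹)ᴴ) =
        Matrix.diagonal (fun i => (s i)⁻¹) * Matrix.diagonal e *
          (Matrix.diagonal fun i => (s i)⁻¹)ᴴ := by
      rw [hZ]; simp only [mul_assoc]
    rw [this, Matrix.diagonal_conjTranspose, Matrix.diagonal_mul_diagonal,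
      Matrix.diagonal_mul_diagonal, ← Matrix.diagonal_one]
    congr 1
    ext i
    have := hs0 i
    simp only [Pi.star_apply, star_inv₀, hstar, ← hss]
    field_simp
  · have h1 : Matrix.diagonal s * Matrix.diagonal (fun i => (s i)⁻¹) = 1 := by
      rw [Matrix.diagonal_mul_diagonal, ← Matrix.diagonal_one]
      congr 1
      ext i
      exact mul_inv_cancel₀ (hs0 i)
    calc Y = K⁻¹ * ((Matrix.diagonal s * Matrix.diagonal (fun i => (s i)⁻¹)) * K) * Y := by
          rw [h1, one_mul, Matrix.nonsing_inv_mul _ hKdet, one_mul]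
      _ = _ := by simp only [mul_assoc]

/-- Equal multisets of values mean fibres of equal cardinality; bijections between the fibres are
glued. -/
theorem exists_equiv_of_map_univ_eq {α β γ : Type*} [Fintype α] [Fintype β] (f : α → γ)
    (g : β → γ) (h : Finset.univ.val.map f = Finset.univ.val.map g) :
    ∃ e : α ≃ β, ∀ a, g (e a) = f a := by
  classical
  have hcard : ∀ c, Fintype.card {a // f a = c} = Fintype.card {b // g b = c} := by
    intro c
    have := congrArg (Multiset.count c) h
    simp only [Multiset.count_map] at this
    rw [Fintype.card_subtype, Fintype.card_subtype]
    simpa [Finset.card, eq_comm] using this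
  exact ⟨Equiv.ofFiberEquiv fun c => Fintype.equivOfCardEq (hcard c),
    fun a => Equiv.ofFiberEquiv_map _ a⟩

/-- The columns of `M` form a basis adapted to the generalized eigenspaces. Their dimensions are the
algebraic multiplicities, so the basis can be reordered to put the moduli in the order of `D`. -/
theorem exists_hyperbolicComponent_eq (A : Matrix (Fin n) (Fin n) ℂ) :
    ∃ M : Matrix (Fin n) (Fin n) ℂ, IsUnit M ∧
      hyperbolicComponent A = M * toComplex (moduliMatrix A) * M⁻¹ := by
  classical
  set s := A.charpoly.roots.toFinset with hs
  let V : s → Submodule ℂ (Fin n → ℂ) := fun μ => genEigenspace A μ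
  have hind : iSupIndep V :=
    (Module.End.independent_maxGenEigenspace (Matrix.toLin' A)).comp Subtype.val_injective
  have htop : iSup V = ⊤ := by
    rw [eq_top_iff, ← Module.End.iSup_maxGenEigenspace_eq_top (Matrix.toLin' A)]
    refine iSup_le fun μ v hv => ?_
    by_cases hv0 : v = 0
    · subst hv0; exact Submodule.zero_mem _
    · have hμ : μ ∈ s := Multiset.mem_toFinset.2 (mem_roots_of_mem_genEigenspace A hv hv0)
      exact le_iSup V ⟨μ, hμ⟩ hv
  have hint := DirectSum.isInternal_submodule_of_iSupIndep_of_iSup_eq_top hind htop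
  let b := hint.collectedBasis fun μ => Module.finBasis ℂ (V μ)
  have hmult : (Finset.univ : Finset (Σ μ : s, Fin (Module.finrank ℂ (V μ)))).val.map
      (fun p => ((p.1 : s) : ℂ)) = A.charpoly.roots := by
    have h1 : ∀ {ι : Type} [Fintype ι] (f : ι → ℂ),
        (Finset.univ : Finset ι).val.map f = ∑ i, ({f i} : Multiset ℂ) := by
      intro ι _ f
      rw [← Multiset.sum_map_singleton (Finset.univ.val.map f), Multiset.map_map]
      rfl
    rw [h1, Fintype.sum_sigma]
    simp only [Finset.sum_const, Finset.card_univ, Fintype.card_fin]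
    have h2 : ∀ μ : s, Module.finrank ℂ (V μ) = A.charpoly.roots.count (μ : ℂ) := by
      intro μ
      rw [Polynomial.count_roots, ← Matrix.charpoly_toLin']
      exact LinearMap.finrank_maxGenEigenspace_eq (Matrix.toLin' A) (μ : ℂ)
    simp only [h2]
    rw [Finset.sum_coe_sort s fun μ => A.charpoly.roots.count μ • ({μ} : Multiset ℂ)]
    exact Multiset.toFinset_sum_count_nsmul_eq _
  obtain ⟨e, he⟩ := exists_equiv_of_map_univ_eq (eigenvalueModuli A)
    (fun p : Σ μ : s, Fin (Module.finrank ℂ (V μ)) => ‖((p.1 : s) : ℂ)‖) (by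
      rw [map_eigenvalueModuli, ← hmult, Multiset.map_map]
      rfl)
  let b' := b.reindex e.symm
  have hMunit : IsUnit ((Pi.basisFun ℂ (Fin n)).toMatrix b') := by
    have := (Pi.basisFun ℂ (Fin n)).invertibleToMatrix b'
    exact isUnit_of_invertible _
  refine ⟨(Pi.basisFun ℂ (Fin n)).toMatrix b', hMunit, ?_⟩
  set M := (Pi.basisFun ℂ (Fin n)).toMatrix b' with hM
  have hdet := (Matrix.isUnit_iff_isUnit_det _).1 hMunit
  have hHM : hyperbolicComponent A * M = M * toComplex (moduliMatrix A) := by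
    rw [toComplex_moduliMatrix]
    ext r i
    have hmem : b' i ∈ genEigenspace A ((e i).1 : ℂ) := by
      simp [b', b, V]
    have := congrFun (hyperbolicComponent_mulVec A _ _ hmem) r
    rw [he i] at this
    rw [Matrix.mul_diagonal]
    simpa [Matrix.mul_apply, Matrix.mulVec, dotProduct, mul_comm, hM, Module.Basis.toMatrix_apply]
      using this
  rw [← hHM, Matrix.mul_assoc, Matrix.mul_nonsing_inv _ hdet, Matrix.mul_one]

/-! ### Real matrices -/

theorem toComplex_eq_mapMatrix (X : Matrix (Fin n) (Fin n) ℝ) :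
    toComplex X = Complex.ofRealHom.mapMatrix X := rfl

theorem toComplex_mul (X Y : Matrix (Fin n) (Fin n) ℝ) :
    toComplex (X * Y) = toComplex X * toComplex Y := by
  simp only [toComplex_eq_mapMatrix, map_mul]

theorem toComplex_one : toComplex (1 : Matrix (Fin n) (Fin n) ℝ) = 1 := by
  simp only [toComplex_eq_mapMatrix, map_one]

theorem toComplex_pow (X : Matrix (Fin n) (Fin n) ℝ) (k : ℕ) :
    toComplex (X ^ k) = toComplex X ^ k := by
  simp only [toComplex_eq_mapMatrix, map_pow]

theorem toComplex_transpose (X : Matrix (Fin n) (Fin n) ℝ) :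
    toComplex Xᵀ = (toComplex X)ᴴ := by
  ext i j
  simp [toComplex]

theorem isUnit_toComplex_iff {X : Matrix (Fin n) (Fin n) ℝ} :
    IsUnit (toComplex X) ↔ IsUnit X := by
  rw [Matrix.isUnit_iff_isUnit_det, Matrix.isUnit_iff_isUnit_det, toComplex_eq_mapMatrix,
    ← RingHom.map_det]
  simp

theorem toComplex_inv {X : Matrix (Fin n) (Fin n) ℝ} (hX : IsUnit X) :
    toComplex X⁻¹ = (toComplex X)⁻¹ := by
  refine (Matrix.inv_eq_right_inv ?_).symm
  rw [← toComplex_mul, Matrix.mul_nonsing_inv _ ((Matrix.isUnit_iff_isUnit_det _).1 hX),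
    toComplex_one]

/-- A positive real matrix is a Gram matrix `Rᵀ R`, a form that survives complexification. -/
theorem toComplex_nonneg {X : Matrix (Fin n) (Fin n) ℝ} (hX : 0 ≤ X) : 0 ≤ toComplex X := by
  have h : CFC.sqrt X * CFC.sqrt X = X := CFC.sqrt_mul_sqrt_self X hX
  have hsa : (CFC.sqrt X)ᴴ = CFC.sqrt X := (IsSelfAdjoint.of_nonneg (CFC.sqrt_nonneg X)).star_eq
  rw [← h, toComplex_mul]
  nth_rewrite 1 [← hsa]
  rw [Matrix.conjTranspose_eq_transpose_of_trivial, toComplex_transpose]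
  exact (Matrix.posSemidef_conjTranspose_mul_self _).nonneg

theorem eq_of_pow_eq_of_nonneg {X Y : Matrix (Fin n) (Fin n) ℂ} (hX : 0 ≤ X) (hY : 0 ≤ Y) {k : ℕ}
    (hk : k ≠ 0) (h : X ^ k = Y ^ k) : X = Y := by
  have hroot : ∀ Z : Matrix (Fin n) (Fin n) ℂ, 0 ≤ Z → (Z ^ k) ^ ((k : ℝ)⁻¹) = Z := by
    intro Z hZ
    rw [← CFC.rpow_natCast Z k hZ,
      CFC.rpow_rpow_of_exponent_nonneg Z _ _ (by positivity) (by positivity) hZ,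
      mul_inv_cancel₀ (by exact_mod_cast hk), CFC.rpow_one Z hZ]
  rw [← hroot X hX, h, hroot Y hY]

/-- Both sides are positive and have the same `2m`-th power, so no compatibility of the functional
calculi is needed. -/
theorem toComplex_absRoot (X : Matrix (Fin n) (Fin n) ℝ) {m : ℕ} (hm : m ≠ 0) :
    toComplex (absRoot X m) = absRoot (toComplex X) m := by
  refine eq_of_pow_eq_of_nonneg (toComplex_nonneg (absRoot_nonneg X m)) (absRoot_nonneg _ m)
    (k := 2 * m) (by omega) ?_
  rw [← toComplex_pow, absRoot_pow _ hm, absRoot_pow _ hm, toComplex_mul,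
    Matrix.conjTranspose_eq_transpose_of_trivial, toComplex_transpose]

theorem tendsto_of_tendsto_toComplex {u : ℕ → Matrix (Fin n) (Fin n) ℝ}
    {X : Matrix (Fin n) (Fin n) ℝ}
    (h : Tendsto (fun m => toComplex (u m)) atTop (𝓝 (toComplex X))) :
    Tendsto u atTop (𝓝 X) := by
  have hcont : Continuous fun Z : Matrix (Fin n) (Fin n) ℂ => Z.map Complex.re :=
    continuous_id.matrix_map Complex.continuous_re
  have h2 := (hcont.tendsto (toComplex X)).comp h
  have hre : ∀ Z : Matrix (Fin n) (Fin n) ℝ, (toComplex Z).map Complex.re = Z := fun Z => by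
    ext i j; simp [toComplex]
  simpa only [Function.comp_def, hre] using h2

/-- Conjugation carries the generalized eigenspace of `μ` to that of its conjugate, and the two
numbers have the same modulus. -/
theorem hyperbolicComponent_toComplex_conj (A : Matrix (Fin n) (Fin n) ℝ) :
    (hyperbolicComponent (toComplex A)).map (starRingEnd ℂ) =
      hyperbolicComponent (toComplex A) := by
  have hconj : ∀ (X : Matrix (Fin n) (Fin n) ℂ) (v : Fin n → ℂ),
      (X.map (starRingEnd ℂ)).mulVec v = star (X.mulVec (star v)) := by
    intro X v
    ext i
    simp [Matrix.mulVec, dotProduct]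
  have hA : (toComplex A).map (starRingEnd ℂ) = toComplex A := by
    ext i j
    simp [toComplex]
  refine ext_of_genEigenspace (toComplex A) fun μ v hv => ?_
  have hstep : ∀ w : Fin n → ℂ,
      (Matrix.toLin' (toComplex A) - (starRingEnd ℂ μ) • (1 : Module.End ℂ (Fin n → ℂ))) (star w) =
        star ((Matrix.toLin' (toComplex A) - μ • (1 : Module.End ℂ (Fin n → ℂ))) w) := by
    intro w
    have := hconj (toComplex A) (star w)
    rw [hA, star_star] at this
    simp [this]
  have hpow : ∀ (k : ℕ) (w : Fin n → ℂ),
      ((Matrix.toLin' (toComplex A) - (starRingEnd ℂ μ) • (1 : Module.End ℂ (Fin n → ℂ))) ^ k)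
        (star w) =
        star (((Matrix.toLin' (toComplex A) - μ • (1 : Module.End ℂ (Fin n → ℂ))) ^ k) w) := by
    intro k
    induction k with
    | zero => simp
    | succ k ih =>
      intro w
      rw [pow_succ, Module.End.mul_apply, hstep, ih, ← Module.End.mul_apply, ← pow_succ]
  have hmem : star v ∈ genEigenspace (toComplex A) (starRingEnd ℂ μ) := by
    rw [genEigenspace, Module.End.mem_maxGenEigenspace] at hv ⊢
    obtain ⟨k, hk⟩ := hv
    exact ⟨k, by rw [hpow, hk, star_zero]⟩
  rw [hconj, hyperbolicComponent_mulVec _ _ _ hmem, hyperbolicComponent_mulVec _ _ _ hv]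
  ext i
  simp

/-- Real matrices that are similar over `ℂ` are similar over `ℝ`. -/
theorem exists_real_similarity {H D : Matrix (Fin n) (Fin n) ℝ} {M : Matrix (Fin n) (Fin n) ℂ}
    (hM : IsUnit M) (h : toComplex H * M = M * toComplex D) :
    ∃ N : Matrix (Fin n) (Fin n) ℝ, IsUnit N ∧ H * N = N * D := by
  set M₁ := M.map Complex.re with hM₁
  set M₂ := M.map Complex.im with hM₂
  have h1 : H * M₁ = M₁ * D := by
    ext i j
    have := congrArg Complex.re (congrFun (congrFun h i) j)
    simpa [Matrix.mul_apply, toComplex, hM₁] using this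
  have h2 : H * M₂ = M₂ * D := by
    ext i j
    have := congrArg Complex.im (congrFun (congrFun h i) j)
    simpa [Matrix.mul_apply, toComplex, hM₂] using this
  -- `p(t) = det(M₁ + t M₂)` takes the value `det M ≠ 0` at `t = i`, so it is a nonzero polynomial
  -- and some real `t` is not a root. Every real combination of `M₁` and `M₂` still intertwines `H`
  -- and `D`.
  let p : Polynomial ℝ := (M₁.map Polynomial.C + (Polynomial.X : Polynomial ℝ) •
    M₂.map Polynomial.C).det
  have hMdec : M = toComplex M₁ + Complex.I • toComplex M₂ := by
    ext i j
    simp [toComplex, hM₁, hM₂, mul_comm Complex.I]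
  have hpI : p.eval₂ Complex.ofRealHom Complex.I = M.det := by
    rw [← Polynomial.coe_eval₂RingHom, RingHom.map_det]
    congr 1
    rw [hMdec]
    ext i j
    simp [toComplex]
    ring
  have hp0 : p ≠ 0 := by
    intro hp
    rw [hp, Polynomial.eval₂_zero] at hpI
    exact ((Matrix.isUnit_iff_isUnit_det _).1 hM).ne_zero hpI.symm
  obtain ⟨t, ht⟩ : ∃ t : ℝ, p.eval t ≠ 0 := by
    by_contra! hcon
    exact hp0 (Polynomial.funext fun t => by simpa using hcon t)
  refine ⟨M₁ + t • M₂, ?_, ?_⟩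
  · rw [Matrix.isUnit_iff_isUnit_det, isUnit_iff_ne_zero]
    convert! ht using 1
    rw [← Polynomial.coe_evalRingHom, RingHom.map_det]
    congr 1
    ext i j
    simp
    ring
  · rw [Matrix.mul_add, Matrix.add_mul, Matrix.mul_smul, Matrix.smul_mul, h1, h2]

theorem exists_real_hyperbolicComponent_eq (A : Matrix (Fin n) (Fin n) ℝ) :
    ∃ M : Matrix (Fin n) (Fin n) ℝ, IsUnit M ∧
      hyperbolicComponent (toComplex A) = toComplex (M * moduliMatrix (toComplex A) * M⁻¹) := by
  obtain ⟨M, hM, hH⟩ := exists_hyperbolicComponent_eq (toComplex A)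
  obtain ⟨H, hHr⟩ : ∃ H : Matrix (Fin n) (Fin n) ℝ,
      hyperbolicComponent (toComplex A) = toComplex H := by
    refine ⟨(hyperbolicComponent (toComplex A)).map Complex.re, ?_⟩
    ext i j
    have := congrFun (congrFun (hyperbolicComponent_toComplex_conj A) i) j
    rw [Matrix.map_apply, Complex.conj_eq_iff_re] at this
    simpa [toComplex] using this.symm
  have hdet := (Matrix.isUnit_iff_isUnit_det _).1 hM
  obtain ⟨N, hN, hHN⟩ := exists_real_similarity (H := H) (D := moduliMatrix (toComplex A)) hM (by
    rw [← hHr, hH, Matrix.mul_assoc, Matrix.nonsing_inv_mul _ hdet, Matrix.mul_one])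
  refine ⟨N, hN, ?_⟩
  rw [hHr, ← hHN, Matrix.mul_assoc, Matrix.mul_nonsing_inv _
    ((Matrix.isUnit_iff_isUnit_det _).1 hN), Matrix.mul_one]

theorem tendsto_absRoot_real {A B C M L Q : Matrix (Fin n) (Fin n) ℝ} (hB : IsUnit B)
    (hC : IsUnit C) (hM : IsUnit M)
    (hH : hyperbolicComponent (toComplex A) = toComplex (M * moduliMatrix (toComplex A) * M⁻¹))
    (hL : L.IsLowerTriangular) (hQ : Q ∈ Matrix.orthogonalGroup (Fin n) ℝ)
    (hMC : M⁻¹ * C = L * Q) :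
    Tendsto (fun m : ℕ => absRoot (B * A ^ m * C) m) atTop
      (𝓝 (Qᵀ * moduliMatrix (toComplex A) * Q)) := by
  apply tendsto_of_tendsto_toComplex
  have hQ' : toComplex Q ∈ Matrix.unitaryGroup (Fin n) ℂ := by
    rw [Matrix.mem_unitaryGroup_iff, Matrix.star_eq_conjTranspose, ← toComplex_transpose,
      ← toComplex_mul, ← toComplex_one]
    congr 1
    exact (Matrix.mem_orthogonalGroup_iff _ _).1 hQ
  have hL' : (toComplex L).IsLowerTriangular := fun i j hij => by
    simp [toComplex, hL hij]
  have := tendsto_absRoot (A := toComplex A) (isUnit_toComplex_iff.2 hB)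
    (isUnit_toComplex_iff.2 hC) (isUnit_toComplex_iff.2 hM)
    (by rw [hH, toComplex_mul, toComplex_mul, toComplex_inv hM]) hL' hQ'
    (by rw [← toComplex_inv hM, ← toComplex_mul, hMC, toComplex_mul])
  rw [toComplex_mul, toComplex_mul, toComplex_transpose]
  refine this.congr' ?_
  filter_upwards [eventually_ne_atTop 0] with m hm
  rw [toComplex_absRoot _ hm, toComplex_mul, toComplex_mul, toComplex_pow]

/-! ### Growth of orbits -/

theorem SubexpGrowth.norm {E : Type*} [SeminormedAddCommGroup E] {u : ℕ → E} (hu : SubexpGrowth u) :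
    SubexpGrowth (fun m => ‖u m‖) := by
  intro r hr
  simpa only [norm_norm] using hu r hr

/-- For each `q > 1` the `m`-th root is eventually between `q⁻¹ r` and `q r`; then `q → 1`. The case
`r = 0` is included. -/
theorem tendsto_rpow_one_div_of_subexpGrowth {a u v : ℕ → ℝ} {r : ℝ} (ha : ∀ m, 0 ≤ a m)
    (hr : 0 ≤ r) (hu : SubexpGrowth u) (hv : SubexpGrowth v)
    (hau : ∀ᶠ m in atTop, a m ≤ u m * r ^ m) (hav : ∀ᶠ m in atTop, r ^ m ≤ v m * a m) :
    Tendsto (fun m : ℕ => a m ^ (1 / (m : ℝ))) atTop (𝓝 r) := by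
  have hbound : ∀ q : ℝ, 1 < q → ∀ᶠ m : ℕ in atTop,
      q⁻¹ * r ≤ a m ^ (1 / (m : ℝ)) ∧ a m ^ (1 / (m : ℝ)) ≤ q * r := by
    intro q hq
    have hq0 : 0 < q := by linarith
    filter_upwards [hau, hav, hu q hq, hv q hq, eventually_ne_atTop 0] with m h1 h2 h3 h4 hm
    have hroot : (a m ^ (1 / (m : ℝ))) ^ m = a m := by
      rw [one_div, Real.rpow_inv_natCast_pow (ha m) hm]
    have hrm : 0 ≤ r ^ m := pow_nonneg hr m
    constructor
    · refine le_of_pow_le_pow_left₀ hm (Real.rpow_nonneg (ha m) _) ?_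
      rw [hroot, mul_pow, inv_pow, inv_mul_le_iff₀ (pow_pos hq0 m)]
      exact h2.trans (mul_le_mul_of_nonneg_right ((le_abs_self _).trans h4) (ha m))
    · refine le_of_pow_le_pow_left₀ hm (mul_nonneg hq0.le hr) ?_
      rw [hroot, mul_pow]
      exact h1.trans (mul_le_mul_of_nonneg_right ((le_abs_self _).trans h3) hrm)
  have hlim1 : Tendsto (fun q : ℝ => q⁻¹ * r) (𝓝[>] 1) (𝓝 r) := by
    have : ContinuousAt (fun q : ℝ => q⁻¹ * r) 1 := by fun_prop (disch := norm_num)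
    have h := this.tendsto
    simp only [inv_one, one_mul] at h
    exact h.mono_left nhdsWithin_le_nhds
  have hlim2 : Tendsto (fun q : ℝ => q * r) (𝓝[>] 1) (𝓝 r) := by
    have : ContinuousAt (fun q : ℝ => q * r) 1 := by fun_prop
    have h := this.tendsto
    simp only [one_mul] at h
    exact h.mono_left nhdsWithin_le_nhds
  rw [tendsto_order]
  constructor
  · intro b hb
    obtain ⟨q, hq1, hq2⟩ := ((hlim1.eventually_const_lt hb).and self_mem_nhdsWithin).exists
    filter_upwards [hbound q hq2] with m hm
    exact hq1.trans_le hm.1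
  · intro b hb
    obtain ⟨q, hq1, hq2⟩ := ((hlim2.eventually_lt_const hb).and self_mem_nhdsWithin).exists
    filter_upwards [hbound q hq2] with m hm
    exact hm.2.trans_lt hq1

/-- `a(m+k)^{1/m}` is `a(m+k)^{1/(m+k)}` raised to the power `1 + k/m`, which tends to 1. The
limiting exponent is positive, so `r = 0` is allowed. -/
theorem tendsto_rpow_one_div_add {a : ℕ → ℝ} {r : ℝ} (ha : ∀ m, 0 ≤ a m) (k : ℕ)
    (h : Tendsto (fun m : ℕ => a m ^ (1 / (m : ℝ))) atTop (𝓝 r)) :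
    Tendsto (fun m : ℕ => a (m + k) ^ (1 / (m : ℝ))) atTop (𝓝 r) := by
  have h1 := h.comp (tendsto_add_atTop_nat k)
  have h2 : Tendsto (fun m : ℕ => 1 + (k : ℝ) / m) atTop (𝓝 (1 + 0)) :=
    tendsto_const_nhds.add (tendsto_const_div_atTop_nhds_zero_nat (k : ℝ))
  rw [add_zero] at h2
  have h3 := h1.rpow h2 (Or.inr one_pos)
  rw [Real.rpow_one] at h3
  refine h3.congr' ?_
  filter_upwards [eventually_ne_atTop 0] with m hm
  have hm' : (m : ℝ) ≠ 0 := by exact_mod_cast hm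
  have hmk : ((m + k : ℕ) : ℝ) ≠ 0 := by exact_mod_cast (by omega : m + k ≠ 0)
  rw [Function.comp_apply, ← Real.rpow_mul (ha _)]
  congr 1
  push_cast at hmk ⊢
  field_simp

section Orbits

open scoped Matrix.Norms.L2Operator

theorem norm_diagonal_pow_mulVec_le {d : Fin n → ℝ} (hd : ∀ i, 0 ≤ d i) {r : ℝ} (hr : 0 ≤ r)
    (y : EuclideanSpace ℂ (Fin n)) (hy : ∀ i, y i ≠ 0 → d i ≤ r) (m : ℕ) :
    ‖Matrix.toEuclideanCLM (𝕜 := ℂ) (Matrix.diagonal (fun i => (d i : ℂ)) ^ m) y‖ ≤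
      r ^ m * ‖y‖ := by
  rw [← abs_of_nonneg (pow_nonneg hr m), ← Real.norm_eq_abs, ← Complex.norm_real, ← norm_smul,
    EuclideanSpace.norm_eq, EuclideanSpace.norm_eq]
  refine Real.sqrt_le_sqrt (Finset.sum_le_sum fun i _ => ?_)
  refine pow_le_pow_left₀ (norm_nonneg _) ?_ 2
  rw [Matrix.ofLp_toEuclideanCLM, Matrix.diagonal_pow, Matrix.mulVec_diagonal, PiLp.smul_apply,
    smul_eq_mul, norm_mul, norm_mul]
  by_cases h : y i = 0
  · simp [h]
  · refine mul_le_mul_of_nonneg_right ?_ (norm_nonneg _)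
    rw [Pi.pow_apply, norm_pow, Complex.norm_real, Complex.norm_real, Real.norm_of_nonneg (hd i),
      Real.norm_of_nonneg (pow_nonneg hr m)]
    exact pow_le_pow_left₀ (hd i) (hy i h) m

/-- If the coordinates of `x` in a basis of eigenvectors of the hyperbolic component belong to
moduli at most `r`, and `r` occurs, then `‖Aᵐ x‖` grows like `rᵐ`. -/
theorem tendsto_norm_pow {A M : Matrix (Fin n) (Fin n) ℂ} (hM : IsUnit M)
    (hH : hyperbolicComponent A = M * toComplex (moduliMatrix A) * M⁻¹)
    (x : EuclideanSpace ℂ (Fin n)) {r : ℝ}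
    (hle : ∀ i, (M⁻¹ *ᵥ x.ofLp) i ≠ 0 → eigenvalueModuli A i ≤ r)
    (hex : ∃ i, (M⁻¹ *ᵥ x.ofLp) i ≠ 0 ∧ eigenvalueModuli A i = r) :
    Tendsto (fun m : ℕ => ‖Matrix.toEuclideanCLM (𝕜 := ℂ) (A ^ m) x‖ ^ (1 / (m : ℝ))) atTop
      (𝓝 r) := by
  obtain ⟨i, hi, hir⟩ := hex
  have hr : 0 ≤ r := hir ▸ eigenvalueModuli_nonneg A i
  set y : EuclideanSpace ℂ (Fin n) := Matrix.toEuclideanCLM (𝕜 := ℂ) M⁻¹ x with hy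
  have hyi : ∀ j, y j = (M⁻¹ *ᵥ x.ofLp) j := fun j => rfl
  set D := toComplex (moduliMatrix A) with hD
  have hDd : D = Matrix.diagonal (fun i => (eigenvalueModuli A i : ℂ)) := toComplex_moduliMatrix A
  set U := unimodularPart A with hU
  have hUunit : IsUnit U := isUnit_unimodularPart A
  have hUdet := (Matrix.isUnit_iff_isUnit_det _).1 hUunit
  have hMdet := (Matrix.isUnit_iff_isUnit_det _).1 hM
  have happ : ∀ (X : Matrix (Fin n) (Fin n) ℂ) (w : EuclideanSpace ℂ (Fin n)),
      ‖Matrix.toEuclideanCLM (𝕜 := ℂ) X w‖ ≤ ‖X‖ * ‖w‖ := fun X w =>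
    (Matrix.toEuclideanCLM (𝕜 := ℂ) X).le_opNorm w
  have hmul : ∀ (X Y : Matrix (Fin n) (Fin n) ℂ) (w : EuclideanSpace ℂ (Fin n)),
      Matrix.toEuclideanCLM (𝕜 := ℂ) (X * Y) w =
        Matrix.toEuclideanCLM (𝕜 := ℂ) X (Matrix.toEuclideanCLM (𝕜 := ℂ) Y w) := fun X Y w => by
    rw [map_mul]; rfl
  -- The upper bound applies `U^m M` to `D^m y`. The lower bound undoes this with `M⁻¹ U⁻¹^m` and
  -- keeps only the coordinate `i`, where `D^m y` has modulus `r^m |y i|`.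
  refine tendsto_rpow_one_div_of_subexpGrowth (u := fun m => ‖U ^ m‖ * (‖M‖ * ‖y‖))
    (v := fun m => ‖U⁻¹ ^ m‖ * (‖y i‖⁻¹ * ‖M⁻¹‖)) (fun m => norm_nonneg _) hr
    ((subexpGrowth_unimodularPart A).norm.mul (.const _))
    ((subexpGrowth_inv_unimodularPart A).norm.mul (.const _)) ?_ ?_
  · filter_upwards [eventually_gt_atTop n] with m hm
    rw [pow_eq_of_hyperbolicComponent_eq hM hH hm, hmul, hmul, hmul]
    have h1 := norm_diagonal_pow_mulVec_le (eigenvalueModuli_nonneg A) hr y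
      (fun j hj => hle j hj) m
    rw [← hDd] at h1
    calc _ ≤ ‖U ^ m‖ * (‖M‖ * (r ^ m * ‖y‖)) := by
          refine (happ _ _).trans (mul_le_mul_of_nonneg_left ?_ (norm_nonneg _))
          exact (happ _ _).trans (mul_le_mul_of_nonneg_left h1 (norm_nonneg _))
      _ = _ := by ring
  · filter_upwards [eventually_gt_atTop n] with m hm
    have hUU : U⁻¹ ^ m * U ^ m = 1 := by
      rw [← Commute.mul_pow, Matrix.nonsing_inv_mul _ hUdet, one_pow]
      rw [Commute, SemiconjBy, Matrix.nonsing_inv_mul _ hUdet, Matrix.mul_nonsing_inv _ hUdet]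
    have h1 : Matrix.toEuclideanCLM (𝕜 := ℂ) (D ^ m) y =
        Matrix.toEuclideanCLM (𝕜 := ℂ) (M⁻¹ * U⁻¹ ^ m)
          (Matrix.toEuclideanCLM (𝕜 := ℂ) (A ^ m) x) := by
      rw [hy, ← hmul, ← hmul]
      congr 2
      rw [pow_eq_of_hyperbolicComponent_eq hM hH hm]
      calc D ^ m * M⁻¹ = (M⁻¹ * ((U⁻¹ ^ m * U ^ m) * M)) * (D ^ m * M⁻¹) := by
            rw [hUU, one_mul, Matrix.nonsing_inv_mul _ hMdet, one_mul]
        _ = _ := by simp only [mul_assoc]; rfl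
    have h2 : ‖Matrix.toEuclideanCLM (𝕜 := ℂ) (D ^ m) y i‖ = r ^ m * ‖y i‖ := by
      rw [Matrix.ofLp_toEuclideanCLM, hDd, Matrix.diagonal_pow, Matrix.mulVec_diagonal, norm_mul,
        Pi.pow_apply, norm_pow, Complex.norm_real, hir, Real.norm_of_nonneg hr]
    have h3 : r ^ m * ‖y i‖ ≤
        ‖M⁻¹‖ * ‖U⁻¹ ^ m‖ * ‖Matrix.toEuclideanCLM (𝕜 := ℂ) (A ^ m) x‖ := by
      rw [← h2]
      refine (PiLp.norm_apply_le _ i).trans ?_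
      rw [h1]
      exact (happ _ _).trans (mul_le_mul_of_nonneg_right (norm_mul_le _ _) (norm_nonneg _))
    have hy0 : 0 < ‖y i‖ := norm_pos_iff.2 hi
    rw [← le_div_iff₀ hy0] at h3
    refine h3.trans (le_of_eq ?_)
    field_simp

end Orbits

/-! ### Spectral projections of the diagonalizable part -/

theorem iSup_eigenspace_eq_top_of_isDiagonalizable {S : Matrix (Fin n) (Fin n) ℂ}
    (hS : IsDiagonalizable S) :
    ⨆ μ : ℂ, Module.End.eigenspace (Matrix.toLin' S) μ = ⊤ := by
  obtain ⟨P, hP, hdiag⟩ := hS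
  have hdet := (Matrix.isUnit_iff_isUnit_det _).1 hP
  rw [eq_top_iff]
  intro v _
  have hv : v = P *ᵥ (P⁻¹ *ᵥ v) := by
    rw [Matrix.mulVec_mulVec, Matrix.mul_nonsing_inv _ hdet, Matrix.one_mulVec]
  have hSP : S * P = P * Matrix.diagonal (Matrix.diag (P⁻¹ * S * P)) := by
    rw [hdiag.diagonal_diag, ← mul_assoc, ← mul_assoc, Matrix.mul_nonsing_inv _ hdet, one_mul]
  rw [hv, Matrix.mulVec_eq_sum]
  refine Submodule.sum_mem _ fun i _ => ?_
  rw [op_smul_eq_smul]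
  refine Submodule.smul_mem _ _ (Submodule.mem_iSup_of_mem (Matrix.diag (P⁻¹ * S * P) i) ?_)
  rw [Module.End.mem_eigenspace_iff, Matrix.toLin'_apply]
  ext r
  have := congrFun (congrFun hSP r) i
  rw [Matrix.mul_diagonal] at this
  simpa [Matrix.mul_apply, Matrix.mulVec, dotProduct, mul_comm] using this

/-- On the `μ`-eigenspace of `S` the operator `A - μ` acts as the nilpotent `N`, which gives one
inclusion. Since the eigenspaces of `S` already span the whole space, the inclusions must be
equalities. -/
theorem mem_genEigenspace_iff_of_jordanChevalley {A S N : Matrix (Fin n) (Fin n) ℂ}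
    (hA : A = S + N) (hSN : Commute S N) (hS : IsDiagonalizable S) (hN : IsNilpotent N) {μ : ℂ}
    {v : Fin n → ℂ} : v ∈ genEigenspace A μ ↔ S *ᵥ v = μ • v := by
  have hsub : ∀ (ν : ℂ), Module.End.eigenspace (Matrix.toLin' S) ν ≤ genEigenspace A ν := by
    intro ν w hw
    rw [Module.End.mem_eigenspace_iff, Matrix.toLin'_apply] at hw
    obtain ⟨k, hk⟩ := hN
    have hpow : ∀ j : ℕ,
        ((Matrix.toLin' A - ν • (1 : Module.End ℂ (Fin n → ℂ))) ^ j) w = (N ^ j) *ᵥ w := by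
      intro j
      induction j with
      | zero => simp
      | succ j ih =>
        have hcomm : S *ᵥ ((N ^ j) *ᵥ w) = ν • ((N ^ j) *ᵥ w) := by
          rw [Matrix.mulVec_mulVec, (hSN.pow_right j).eq, ← Matrix.mulVec_mulVec, hw,
            Matrix.mulVec_smul]
        rw [pow_succ', Module.End.mul_apply, ih, LinearMap.sub_apply, Matrix.toLin'_apply, hA,
          Matrix.add_mulVec, hcomm, LinearMap.smul_apply, Module.End.one_apply, add_sub_cancel_left,
          Matrix.mulVec_mulVec, ← pow_succ']
    rw [genEigenspace, Module.End.mem_maxGenEigenspace]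
    exact ⟨k, by rw [hpow, hk, Matrix.zero_mulVec]⟩
  constructor
  · intro hv
    -- With `E` the spectral projection of `A` for `μ`, the identity `S E = μ E` is tested on
    -- eigenvectors of `S`, each of which `E` either fixes or kills.
    have hX : S * genEigenspaceScaling A (fun ν => if ν = μ then 1 else 0) =
        μ • genEigenspaceScaling A (fun ν => if ν = μ then 1 else 0) := by
      apply Matrix.toLin'.injective
      have htop : (⊤ : Submodule ℂ (Fin n → ℂ)) ≤ LinearMap.eqLocus
          (Matrix.toLin' (S * genEigenspaceScaling A (fun ν => if ν = μ then 1 else 0)))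
          (Matrix.toLin' (μ • genEigenspaceScaling A (fun ν => if ν = μ then 1 else 0))) := by
        rw [← iSup_eigenspace_eq_top_of_isDiagonalizable hS]
        refine iSup_le fun ν w hw => ?_
        have hw' := hsub ν hw
        rw [Module.End.mem_eigenspace_iff, Matrix.toLin'_apply] at hw
        rw [LinearMap.mem_eqLocus, Matrix.toLin'_apply, Matrix.toLin'_apply,
          ← Matrix.mulVec_mulVec, Matrix.smul_mulVec, genEigenspaceScaling_mulVec A _ hw',
          Matrix.mulVec_smul, hw]
        split_ifs with h
        · simp [h]
        · simp
      exact LinearMap.ext fun v => htop (x := v) trivial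
    have h := congrArg (fun X : Matrix (Fin n) (Fin n) ℂ => X *ᵥ v) hX
    simpa [← Matrix.mulVec_mulVec, Matrix.smul_mulVec, genEigenspaceScaling_mulVec A _ hv] using h
  · intro hv
    refine hsub μ ?_
    rwa [Module.End.mem_eigenspace_iff, Matrix.toLin'_apply]

theorem mulVec_col_of_hyperbolicComponent_eq {A M : Matrix (Fin n) (Fin n) ℂ} (hM : IsUnit M)
    (hH : hyperbolicComponent A = M * toComplex (moduliMatrix A) * M⁻¹) (i : Fin n) :
    hyperbolicComponent A *ᵥ M.col i = (eigenvalueModuli A i : ℂ) • M.col i := by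
  have h : hyperbolicComponent A * M = M * Matrix.diagonal (fun i => (eigenvalueModuli A i : ℂ)) := by
    rw [hH, mul_assoc, Matrix.nonsing_inv_mul _ ((Matrix.isUnit_iff_isUnit_det _).1 hM), mul_one,
      toComplex_moduliMatrix]
  ext r
  have := congrFun (congrFun h r) i
  rw [Matrix.mul_diagonal] at this
  simpa [Matrix.mul_apply, Matrix.mulVec, dotProduct, mul_comm] using this

/-- The span of the eigenvectors of the diagonalizable part for eigenvalues of modulus at most `t`,
in coordinates given by eigenvectors of the hyperbolic component. -/
theorem mem_span_eigenvectors_iff {A S N M : Matrix (Fin n) (Fin n) ℂ}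
    (hA : A = S + N) (hSN : Commute S N) (hS : IsDiagonalizable S) (hN : IsNilpotent N)
    (hM : IsUnit M) (hH : hyperbolicComponent A = M * toComplex (moduliMatrix A) * M⁻¹) (t : ℝ)
    (x : EuclideanSpace ℂ (Fin n)) :
    x ∈ Submodule.span ℂ {x : EuclideanSpace ℂ (Fin n) |
      ∃ μ : ℂ, ‖μ‖ ≤ t ∧ Matrix.toEuclideanCLM (𝕜 := ℂ) S x = μ • x} ↔
      ∀ i, (M⁻¹ *ᵥ x.ofLp) i ≠ 0 → eigenvalueModuli A i ≤ t := by
  have hMdet := (Matrix.isUnit_iff_isUnit_det _).1 hM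
  constructor
  · intro hx
    induction hx using Submodule.span_induction with
    | mem x hx =>
      obtain ⟨μ, hμ, hSx⟩ := hx
      have hSx' : S *ᵥ x.ofLp = μ • x.ofLp := congrArg WithLp.ofLp hSx
      have hHx := hyperbolicComponent_mulVec A μ _
        ((mem_genEigenspace_iff_of_jordanChevalley hA hSN hS hN).2 hSx')
      intro i hi
      have h1 : Matrix.diagonal (fun i => (eigenvalueModuli A i : ℂ)) *ᵥ (M⁻¹ *ᵥ x.ofLp) =
          ((‖μ‖ : ℝ) : ℂ) • (M⁻¹ *ᵥ x.ofLp) := by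
        rw [← Matrix.mulVec_smul, ← hHx, hH, ← toComplex_moduliMatrix, Matrix.mulVec_mulVec,
          Matrix.mulVec_mulVec, ← mul_assoc, ← mul_assoc, Matrix.nonsing_inv_mul _ hMdet, one_mul]
      have h2 := congrFun h1 i
      rw [Matrix.mulVec_diagonal, Pi.smul_apply, smul_eq_mul] at h2
      have h3 := mul_right_cancel₀ hi h2
      rw [Complex.ofReal_inj] at h3
      exact h3.trans_le hμ
    | zero => simp
    | add x y _ _ hx hy =>
      intro i hi
      by_contra hlt
      apply hi
      rw [WithLp.ofLp_add, Matrix.mulVec_add, Pi.add_apply, not_not.1 (mt (hx i) hlt),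
        not_not.1 (mt (hy i) hlt), add_zero]
    | smul c x _ hx =>
      intro i hi
      refine hx i fun h => hi ?_
      rw [WithLp.ofLp_smul, Matrix.mulVec_smul, Pi.smul_apply, h, smul_zero]
  · intro hx
    have hdec : x = ∑ i, (M⁻¹ *ᵥ x.ofLp) i • WithLp.toLp 2 (M.col i) := by
      apply WithLp.ofLp_injective 2
      rw [WithLp.ofLp_sum]
      have h : M *ᵥ (M⁻¹ *ᵥ x.ofLp) = x.ofLp := by
        rw [Matrix.mulVec_mulVec, Matrix.mul_nonsing_inv _ hMdet, Matrix.one_mulVec]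
      conv_lhs => rw [← h, Matrix.mulVec_eq_sum]
      refine Finset.sum_congr rfl fun i _ => ?_
      rw [op_smul_eq_smul]
      rfl
    rw [hdec]
    refine Submodule.sum_mem _ fun i _ => ?_
    by_cases hi : (M⁻¹ *ᵥ x.ofLp) i = 0
    · rw [hi, zero_smul]; exact Submodule.zero_mem _
    refine Submodule.smul_mem _ _ ?_
    -- A column of `M` is an eigenvector of `H` but may mix several `μ` of the same modulus. Its
    -- spectral components are eigenvectors of `S`, and each nonzero one belongs to a `μ` with `|μ|
    -- = d_i`.
    have hcol : M.col i = ∑ μ ∈ A.charpoly.roots.toFinset,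
        genEigenspaceScaling A (fun ν => if ν = μ then 1 else 0) *ᵥ M.col i := by
      rw [← Matrix.sum_mulVec, sum_genEigenspaceScaling_single, Matrix.one_mulVec]
    rw [hcol, WithLp.toLp_sum]
    refine Submodule.sum_mem _ fun μ _ => ?_
    set w := genEigenspaceScaling A (fun ν => if ν = μ then 1 else 0) *ᵥ M.col i with hw
    have hwmem : w ∈ genEigenspace A μ := genEigenspaceScaling_single_mulVec_mem A μ _
    by_cases hw0 : w = 0
    · rw [hw0, WithLp.toLp_zero]; exact Submodule.zero_mem _
    refine Submodule.subset_span ⟨μ, ?_, ?_⟩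
    · have hcomm : hyperbolicComponent A *
          genEigenspaceScaling A (fun ν => if ν = μ then 1 else 0) =
          genEigenspaceScaling A (fun ν => if ν = μ then 1 else 0) * hyperbolicComponent A := by
        refine ext_of_genEigenspace A fun ν u hu => ?_
        rw [← Matrix.mulVec_mulVec, ← Matrix.mulVec_mulVec, genEigenspaceScaling_mulVec A _ hu,
          hyperbolicComponent_mulVec A _ _ hu, Matrix.mulVec_smul, Matrix.mulVec_smul,
          genEigenspaceScaling_mulVec A _ hu, hyperbolicComponent_mulVec A _ _ hu, smul_comm]
      have h1 : hyperbolicComponent A *ᵥ w = (eigenvalueModuli A i : ℂ) • w := by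
        rw [hw, Matrix.mulVec_mulVec, hcomm, ← Matrix.mulVec_mulVec,
          mulVec_col_of_hyperbolicComponent_eq hM hH, Matrix.mulVec_smul]
      rw [hyperbolicComponent_mulVec A _ _ hwmem] at h1
      have h2 := smul_left_injective ℂ hw0 h1
      rw [Complex.ofReal_inj] at h2
      exact h2.trans_le (hx i hi)
    · apply WithLp.ofLp_injective 2
      exact (mem_genEigenspace_iff_of_jordanChevalley hA hSN hS hN).1 hwmem

theorem imageOf_spectralProjection (S : Matrix (Fin n) (Fin n) ℂ) (t : ℝ) :
    imageOf (spectralProjection S t) =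
      (Submodule.span ℂ {x : EuclideanSpace ℂ (Fin n) |
        ∃ μ : ℂ, ‖μ‖ ≤ t ∧ Matrix.toEuclideanCLM (𝕜 := ℂ) S x = μ • x} : Set _) := by
  rw [imageOf, spectralProjection, StarAlgEquiv.apply_symm_apply]
  exact congrArg SetLike.coe (Submodule.range_starProjection _)

/-- The indices with `d i ≤ t` form a final segment, and a lower triangular matrix moves supports
only to later indices. -/
theorem le_of_mulVec_apply_ne_zero {d : Fin n → ℝ} (hd : Antitone d)
    {L : Matrix (Fin n) (Fin n) ℂ} (hL : L.IsLowerTriangular) {t : ℝ} {z : Fin n → ℂ}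
    (hz : ∀ i, z i ≠ 0 → d i ≤ t) (i : Fin n) (hi : (L *ᵥ z) i ≠ 0) : d i ≤ t := by
  by_contra hlt
  apply hi
  change ∑ j, L i j * z j = 0
  refine Finset.sum_eq_zero fun j _ => ?_
  by_cases hij : j ≤ i
  · have h1 : z j = 0 := by
      by_contra h
      have := hz j h
      have := hd hij
      linarith
    rw [h1, mul_zero]
  · rw [hL (i := i) (j := j) (by simpa using hij), zero_mul]

/-- Both `L` and `L⁻¹` preserve the final segment, so the span is cut out by the same indices in the
coordinates `Q x` as in `M⁻¹ x`. As `Q` is unitary, the orthogonal projection is the coordinate one.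
-/
theorem spectralProjection_eq {A S N M L Q : Matrix (Fin n) (Fin n) ℂ}
    (hA : A = S + N) (hSN : Commute S N) (hS : IsDiagonalizable S) (hN : IsNilpotent N)
    (hM : IsUnit M) (hH : hyperbolicComponent A = M * toComplex (moduliMatrix A) * M⁻¹)
    (hL : L.IsLowerTriangular) (hQ : Q ∈ Matrix.unitaryGroup (Fin n) ℂ) (hMLQ : M⁻¹ = L * Q)
    (t : ℝ) :
    spectralProjection S t =
      Qᴴ * Matrix.diagonal (fun i => if eigenvalueModuli A i ≤ t then (1 : ℂ) else 0) * Q := by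
  have hQ1 : Qᴴ * Q = 1 := Matrix.mem_unitaryGroup_iff'.1 hQ
  have hQ2 : Q * Qᴴ = 1 := Matrix.mem_unitaryGroup_iff.1 hQ
  have hLunit : IsUnit L := by
    have h1 : L = M⁻¹ * Qᴴ := by rw [hMLQ, mul_assoc, hQ2, mul_one]
    rw [h1]
    exact (Matrix.isUnit_nonsing_inv_iff.2 hM).mul (IsUnit.of_mul_eq_one _ hQ1)
  have hLdet := (Matrix.isUnit_iff_isUnit_det _).1 hLunit
  set Δ : Matrix (Fin n) (Fin n) ℂ :=
    Matrix.diagonal (fun i => if eigenvalueModuli A i ≤ t then (1 : ℂ) else 0) with hΔ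
  have hΔ2 : Δ * Δ = Δ := by
    rw [hΔ, Matrix.diagonal_mul_diagonal]
    congr 1
    ext i
    split_ifs <;> simp
  have hΔs : Δᴴ = Δ := by
    rw [hΔ, Matrix.diagonal_conjTranspose]
    congr 1
    ext i
    rw [Pi.star_apply]
    split_ifs <;> simp
  have hidem : (Qᴴ * Δ * Q) * (Qᴴ * Δ * Q) = Qᴴ * Δ * Q := by
    calc _ = Qᴴ * (Δ * ((Q * Qᴴ) * Δ)) * Q := by simp only [mul_assoc]
      _ = _ := by rw [hQ2, one_mul, hΔ2]
  have hstar : star (Qᴴ * Δ * Q) = Qᴴ * Δ * Q := by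
    rw [Matrix.star_eq_conjTranspose, Matrix.conjTranspose_mul, Matrix.conjTranspose_mul, hΔs,
      Matrix.conjTranspose_conjTranspose, mul_assoc]
  set T := Matrix.toEuclideanCLM (𝕜 := ℂ) (Qᴴ * Δ * Q) with hT
  have hproj : IsStarProjection T :=
    ⟨by rw [IsIdempotentElem, hT, ← map_mul, hidem],
      by rw [IsSelfAdjoint, hT, ← map_star, hstar]⟩
  have hrange : T.range = Submodule.span ℂ {x : EuclideanSpace ℂ (Fin n) |
      ∃ μ : ℂ, ‖μ‖ ≤ t ∧ Matrix.toEuclideanCLM (𝕜 := ℂ) S x = μ • x} := by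
    ext x
    rw [mem_span_eigenvectors_iff hA hSN hS hN hM hH]
    have h1 : (∀ i, (M⁻¹ *ᵥ x.ofLp) i ≠ 0 → eigenvalueModuli A i ≤ t) ↔
        ∀ i, (Q *ᵥ x.ofLp) i ≠ 0 → eigenvalueModuli A i ≤ t := by
      constructor
      · intro h
        have h2 := le_of_mulVec_apply_ne_zero (eigenvalueModuli_antitone A)
          (IsLowerTriangular.inv hL hLunit) h
        rwa [Matrix.mulVec_mulVec, hMLQ, ← mul_assoc, Matrix.nonsing_inv_mul _ hLdet,
          one_mul] at h2
      · intro h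
        have h2 := le_of_mulVec_apply_ne_zero (eigenvalueModuli_antitone A) hL h
        rwa [Matrix.mulVec_mulVec, ← hMLQ] at h2
    rw [h1]
    constructor
    · rintro ⟨w, rfl⟩ i hi
      by_contra hlt
      apply hi
      have : Q *ᵥ (T w).ofLp = Δ *ᵥ (Q *ᵥ w.ofLp) := by
        rw [hT, Matrix.ofLp_toEuclideanCLM, Matrix.mulVec_mulVec, Matrix.mulVec_mulVec,
          ← mul_assoc, ← mul_assoc, hQ2, one_mul]
      change (Q *ᵥ (T w).ofLp) i = 0
      rw [this, hΔ, Matrix.mulVec_diagonal, if_neg hlt, zero_mul]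
    · intro h
      refine ⟨x, ?_⟩
      apply WithLp.ofLp_injective 2
      change (Qᴴ * Δ * Q) *ᵥ x.ofLp = x.ofLp
      have h2 : Δ *ᵥ (Q *ᵥ x.ofLp) = Q *ᵥ x.ofLp := by
        ext i
        rw [hΔ, Matrix.mulVec_diagonal]
        by_cases hi : (Q *ᵥ x.ofLp) i = 0
        · rw [hi, mul_zero]
        · rw [if_pos (h i hi), one_mul]
      rw [mul_assoc, ← Matrix.mulVec_mulVec, ← Matrix.mulVec_mulVec, h2, Matrix.mulVec_mulVec, hQ1,
        Matrix.one_mulVec]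
  -- A self-adjoint idempotent is determined by its range.
  obtain ⟨_, hT'⟩ := isStarProjection_iff_eq_starProjection_range.1 hproj
  simp only [spectralProjection, ← hrange]
  rw [← hT', hT, StarAlgEquiv.symm_apply_apply]

/-! ### Nayak's theorem -/

theorem exists_index_of_range_eq {A : Matrix (Fin n) (Fin n) ℂ} {s : ℕ} {γ : Fin s → ℝ}
    (hγ : Set.range γ = {r : ℝ | ∃ μ ∈ spectrum ℂ A, ‖μ‖ = r}) :
    ∃ κ : Fin n → Fin s, ∀ i, γ (κ i) = eigenvalueModuli A i := by
  have h : ∀ i, eigenvalueModuli A i ∈ Set.range γ := by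
    intro i
    have h1 : eigenvalueModuli A i ∈ A.charpoly.roots.map (fun z => ‖z‖) := by
      rw [← map_eigenvalueModuli]
      exact Multiset.mem_map_of_mem _ (Finset.mem_univ i)
    obtain ⟨z, hz, hzi⟩ := Multiset.mem_map.1 h1
    rw [hγ]
    refine ⟨z, ?_, hzi⟩
    rw [Polynomial.mem_roots A.charpoly_monic.ne_zero] at hz
    exact Matrix.mem_spectrum_iff_isRoot_charpoly.2 hz
  choose κ hκ using h
  exact ⟨κ, hκ⟩

section Nayak

variable {A S N M L Q : Matrix (Fin n) (Fin n) ℂ} {s : ℕ} {γ : Fin s → ℝ} {κ : Fin n → Fin s}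

/-- The formula remains valid for `k ≥ s`, where the cutoff excludes every index; hence the last
difference in the sum needs no separate treatment. -/
theorem nayakProjection_eq (hA : A = S + N) (hSN : Commute S N) (hS : IsDiagonalizable S)
    (hN : IsNilpotent N) (hM : IsUnit M)
    (hH : hyperbolicComponent A = M * toComplex (moduliMatrix A) * M⁻¹)
    (hL : L.IsLowerTriangular) (hQ : Q ∈ Matrix.unitaryGroup (Fin n) ℂ) (hMLQ : M⁻¹ = L * Q)
    (hγ : StrictAnti γ) (hκ : ∀ i, γ (κ i) = eigenvalueModuli A i) (k : ℕ) :
    nayakProjection S γ k =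
      Qᴴ * Matrix.diagonal (fun i => if k ≤ (κ i : ℕ) then (1 : ℂ) else 0) * Q := by
  by_cases hk : k < s
  · rw [nayakProjection, dif_pos hk, spectralProjection_eq hA hSN hS hN hM hH hL hQ hMLQ]
    congr 3
    ext i
    simp only [← hκ i, hγ.le_iff_ge, Fin.le_def]
  · have : ∀ i, ¬ k ≤ (κ i : ℕ) := fun i => by have := (κ i).isLt; omega
    simp [nayakProjection, hk, this]

theorem mem_imageOf_nayakProjection_iff (hA : A = S + N) (hSN : Commute S N)
    (hS : IsDiagonalizable S) (hN : IsNilpotent N) (hM : IsUnit M)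
    (hH : hyperbolicComponent A = M * toComplex (moduliMatrix A) * M⁻¹)
    (hγ : StrictAnti γ) (hκ : ∀ i, γ (κ i) = eigenvalueModuli A i) (k : ℕ)
    (x : EuclideanSpace ℂ (Fin n)) :
    x ∈ imageOf (nayakProjection S γ k) ↔ ∀ i, (M⁻¹ *ᵥ x.ofLp) i ≠ 0 → k ≤ (κ i : ℕ) := by
  by_cases hk : k < s
  · rw [nayakProjection, dif_pos hk, imageOf_spectralProjection, SetLike.mem_coe,
      mem_span_eigenvectors_iff hA hSN hS hN hM hH]
    refine forall₂_congr fun i _ => ?_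
    rw [← hκ i, hγ.le_iff_ge, Fin.le_def]
  · have hlt : ∀ i, ¬ k ≤ (κ i : ℕ) := fun i => by have := (κ i).isLt; omega
    have h0 : x ∈ imageOf (nayakProjection S γ k) ↔ x = 0 := by
      simp [nayakProjection, hk, imageOf]
    rw [h0]
    constructor
    · rintro rfl i hi
      simp at hi
    · intro h
      have h1 : M⁻¹ *ᵥ x.ofLp = 0 := by
        ext i
        by_contra hi
        exact hlt i (h i hi)
      apply WithLp.ofLp_injective 2
      have h2 : M *ᵥ (M⁻¹ *ᵥ x.ofLp) = x.ofLp := by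
        rw [Matrix.mulVec_mulVec, Matrix.mul_nonsing_inv _ ((Matrix.isUnit_iff_isUnit_det _).1 hM),
          Matrix.one_mulVec]
      rw [← h2, h1, Matrix.mulVec_zero]
      rfl

theorem sum_nayakProjection_eq (hA : A = S + N) (hSN : Commute S N) (hS : IsDiagonalizable S)
    (hN : IsNilpotent N) (hM : IsUnit M)
    (hH : hyperbolicComponent A = M * toComplex (moduliMatrix A) * M⁻¹)
    (hL : L.IsLowerTriangular) (hQ : Q ∈ Matrix.unitaryGroup (Fin n) ℂ) (hMLQ : M⁻¹ = L * Q)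
    (hγ : StrictAnti γ) (hκ : ∀ i, γ (κ i) = eigenvalueModuli A i) :
    ∑ j : Fin s, (γ j : ℂ) • (nayakProjection S γ j - nayakProjection S γ (j + 1)) =
      Qᴴ * toComplex (moduliMatrix A) * Q := by
  have h1 : ∀ j : Fin s, (γ j : ℂ) • (nayakProjection S γ j - nayakProjection S γ (j + 1)) =
      Qᴴ * Matrix.diagonal (fun i => if κ i = j then (γ j : ℂ) else 0) * Q := by
    intro j
    rw [nayakProjection_eq hA hSN hS hN hM hH hL hQ hMLQ hγ hκ,
      nayakProjection_eq hA hSN hS hN hM hH hL hQ hMLQ hγ hκ, ← Matrix.sub_mul, ← Matrix.mul_sub,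
      Matrix.diagonal_sub, ← Matrix.smul_mul, ← Matrix.mul_smul, ← Matrix.diagonal_smul]
    congr 3
    ext i
    simp only [Pi.smul_apply, smul_eq_mul]
    -- The cutoffs at `j` and `j + 1` differ exactly at the indices with `κ i = j`.
    rcases lt_trichotomy (κ i : ℕ) (j : ℕ) with h | h | h
    · rw [if_neg (by omega), if_neg (by omega), if_neg (fun h' => by rw [h'] at h; omega)]
      simp
    · rw [if_pos (by omega), if_neg (by omega), if_pos (Fin.ext h)]
      simp
    · rw [if_pos (by omega), if_pos (by omega), if_neg (fun h' => by rw [h'] at h; omega)]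
      simp
  rw [Finset.sum_congr rfl fun j _ => h1 j, ← Finset.sum_mul, ← Finset.mul_sum,
    toComplex_moduliMatrix]
  congr 2
  ext a b
  rw [Matrix.sum_apply]
  rcases eq_or_ne a b with rfl | hab
  · simp [hκ]
  · simp [Matrix.diagonal_apply_ne _ hab]

theorem tendsto_norm_pow_of_mem_layer (hA : A = S + N) (hSN : Commute S N)
    (hS : IsDiagonalizable S) (hN : IsNilpotent N) (hM : IsUnit M)
    (hH : hyperbolicComponent A = M * toComplex (moduliMatrix A) * M⁻¹)
    (hγ : StrictAnti γ) (hκ : ∀ i, γ (κ i) = eigenvalueModuli A i) (j : Fin s)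
    {x : EuclideanSpace ℂ (Fin n)}
    (hx : x ∈ imageOf (nayakProjection S γ j) \ imageOf (nayakProjection S γ (j + 1))) :
    Tendsto (fun m : ℕ => ‖Matrix.toEuclideanCLM (𝕜 := ℂ) (A ^ m) x‖ ^ (1 / (m : ℝ))) atTop
      (𝓝 (γ j)) := by
  rw [Set.mem_sdiff, mem_imageOf_nayakProjection_iff hA hSN hS hN hM hH hγ hκ,
    mem_imageOf_nayakProjection_iff hA hSN hS hN hM hH hγ hκ] at hx
  obtain ⟨h1, h2⟩ := hx
  push Not at h2
  obtain ⟨i, hi, hij⟩ := h2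
  refine tendsto_norm_pow hM hH x (fun l hl => ?_) ⟨i, hi, ?_⟩
  · rw [← hκ, hγ.le_iff_ge, Fin.le_def]
    exact h1 l hl
  · rw [← hκ]
    congr 1
    have := h1 i hi
    exact Fin.ext (by omega)

theorem exists_mem_layer (hA : A = S + N) (hSN : Commute S N)
    (hS : IsDiagonalizable S) (hN : IsNilpotent N) (hM : IsUnit M)
    (hH : hyperbolicComponent A = M * toComplex (moduliMatrix A) * M⁻¹)
    (hγ : StrictAnti γ) (hκ : ∀ i, γ (κ i) = eigenvalueModuli A i)
    {x : EuclideanSpace ℂ (Fin n)} (hx : x ≠ 0) :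
    ∃ j : Fin s, x ∈ imageOf (nayakProjection S γ j) \ imageOf (nayakProjection S γ (j + 1)) := by
  have hne : (Finset.univ.filter fun i => (M⁻¹ *ᵥ x.ofLp) i ≠ 0).Nonempty := by
    by_contra hcon
    rw [Finset.not_nonempty_iff_eq_empty, Finset.filter_eq_empty_iff] at hcon
    refine hx ?_
    -- At index `s` the projection is zero, so an empty support forces `x = 0`.
    have h1 := (mem_imageOf_nayakProjection_iff hA hSN hS hN hM hH hγ hκ s x).2
      fun i hi => absurd hi (hcon (Finset.mem_univ i))
    simpa [nayakProjection, imageOf, eq_comm] using h1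
  -- The smallest `κ` on the support corresponds to the largest modulus.
  obtain ⟨i, hi, hmin⟩ := Finset.exists_min_image _ (fun i => (κ i : ℕ)) hne
  refine ⟨κ i, ?_, ?_⟩
  · rw [mem_imageOf_nayakProjection_iff hA hSN hS hN hM hH hγ hκ]
    exact fun l hl => hmin l (Finset.mem_filter.2 ⟨Finset.mem_univ l, hl⟩)
  · rw [mem_imageOf_nayakProjection_iff hA hSN hS hN hM hH hγ hκ]
    intro h
    have := h i (Finset.mem_filter.1 hi).2
    omega

/-- The layers cover all nonzero vectors and have distinct growth rates, so the rate determines the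
layer. -/
theorem mem_layer_iff_tendsto (hA : A = S + N) (hSN : Commute S N)
    (hS : IsDiagonalizable S) (hN : IsNilpotent N) (hM : IsUnit M)
    (hH : hyperbolicComponent A = M * toComplex (moduliMatrix A) * M⁻¹)
    (hγ : StrictAnti γ) (hκ : ∀ i, γ (κ i) = eigenvalueModuli A i) (j : Fin s)
    {x : EuclideanSpace ℂ (Fin n)} (hx : x ≠ 0) :
    x ∈ imageOf (nayakProjection S γ j) \ imageOf (nayakProjection S γ (j + 1)) ↔
      Tendsto (fun m : ℕ => ‖Matrix.toEuclideanCLM (𝕜 := ℂ) (A ^ m) x‖ ^ (1 / (m : ℝ))) atTop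
        (𝓝 (γ j)) := by
  refine ⟨tendsto_norm_pow_of_mem_layer hA hSN hS hN hM hH hγ hκ j, fun h => ?_⟩
  obtain ⟨k, hk⟩ := exists_mem_layer hA hSN hS hN hM hH hγ hκ hx
  have h' := tendsto_norm_pow_of_mem_layer hA hSN hS hN hM hH hγ hκ k hk
  rwa [hγ.injective (tendsto_nhds_unique h h')]

theorem tendsto_norm_pow_apply_pow (A : Matrix (Fin n) (Fin n) ℂ)
    (x : EuclideanSpace ℂ (Fin n)) (k : ℕ) {r : ℝ}
    (h : Tendsto (fun m : ℕ => ‖Matrix.toEuclideanCLM (𝕜 := ℂ) (A ^ m) x‖ ^ (1 / (m : ℝ))) atTop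
      (𝓝 r)) :
    Tendsto (fun m : ℕ => ‖Matrix.toEuclideanCLM (𝕜 := ℂ) (A ^ m)
      (Matrix.toEuclideanCLM (𝕜 := ℂ) (A ^ k) x)‖ ^ (1 / (m : ℝ))) atTop (𝓝 r) := by
  have := tendsto_rpow_one_div_add (fun m => norm_nonneg _) k h
  refine this.congr fun m => ?_
  rw [pow_add, map_mul]
  rfl

/-- `x` and `A^k x` have the same growth rate. A positive rate excludes `A^k x = 0`, so both lie in
the same layer. -/
theorem mapsTo_layer (hA : A = S + N) (hSN : Commute S N)
    (hS : IsDiagonalizable S) (hN : IsNilpotent N) (hM : IsUnit M)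
    (hH : hyperbolicComponent A = M * toComplex (moduliMatrix A) * M⁻¹)
    (hγ : StrictAnti γ) (hκ : ∀ i, γ (κ i) = eigenvalueModuli A i) (j : Fin s) (k : ℕ)
    (hj : 0 < γ j) :
    Set.MapsTo (Matrix.toEuclideanCLM (𝕜 := ℂ) (A ^ k))
      (imageOf (nayakProjection S γ j) \ imageOf (nayakProjection S γ (j + 1)))
      (imageOf (nayakProjection S γ j) \ imageOf (nayakProjection S γ (j + 1))) := by
  intro x hx
  have h1 := tendsto_norm_pow_apply_pow A x k
    (tendsto_norm_pow_of_mem_layer hA hSN hS hN hM hH hγ hκ j hx)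
  refine (mem_layer_iff_tendsto hA hSN hS hN hM hH hγ hκ j fun h0 => ?_).2 h1
  rw [h0] at h1
  have h2 : Tendsto (fun m : ℕ => ‖Matrix.toEuclideanCLM (𝕜 := ℂ) (A ^ m)
      (0 : EuclideanSpace ℂ (Fin n))‖ ^ (1 / (m : ℝ))) atTop (𝓝 0) := by
    refine tendsto_const_nhds.congr' ?_
    -- At `m = 0` the exponent `1 / 0` is `0` and the term is `1`.
    filter_upwards [eventually_ne_atTop 0] with m hm
    rw [map_zero, norm_zero, Real.zero_rpow (by simpa using hm)]
  exact hj.ne (tendsto_nhds_unique h2 h1)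

/-- A nonzero `A^k x` lies in the same layer `l` as `x`, and `l ≥ j`; here `γ j = 0` is allowed. -/
theorem mapsTo_imageOf_nayakProjection (hA : A = S + N) (hSN : Commute S N)
    (hS : IsDiagonalizable S) (hN : IsNilpotent N) (hM : IsUnit M)
    (hH : hyperbolicComponent A = M * toComplex (moduliMatrix A) * M⁻¹)
    (hγ : StrictAnti γ) (hκ : ∀ i, γ (κ i) = eigenvalueModuli A i) (j : Fin s) (k : ℕ) :
    Set.MapsTo (Matrix.toEuclideanCLM (𝕜 := ℂ) (A ^ k))
      (imageOf (nayakProjection S γ j)) (imageOf (nayakProjection S γ j)) := by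
  intro x hx
  set z := Matrix.toEuclideanCLM (𝕜 := ℂ) (A ^ k) x with hz
  by_cases hz0 : z = 0
  · rw [hz0]
    exact ⟨0, map_zero _⟩
  have hx0 : x ≠ 0 := by
    rintro rfl
    exact hz0 (map_zero _)
  obtain ⟨l, hl⟩ := exists_mem_layer hA hSN hS hN hM hH hγ hκ hx0
  have h1 := tendsto_norm_pow_apply_pow A x k
    (tendsto_norm_pow_of_mem_layer hA hSN hS hN hM hH hγ hκ l hl)
  have h2 := ((mem_layer_iff_tendsto hA hSN hS hN hM hH hγ hκ l hz0).2 h1).1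
  have hjl : (j : ℕ) ≤ l := by
    have h3 := hl.2
    rw [mem_imageOf_nayakProjection_iff hA hSN hS hN hM hH hγ hκ] at h3 hx
    push Not at h3
    obtain ⟨i, hi, hil⟩ := h3
    have := hx i hi
    omega
  rw [mem_imageOf_nayakProjection_iff hA hSN hS hN hM hH hγ hκ] at h2 ⊢
  exact fun i hi => hjl.trans (h2 i hi)

end Nayak

end MatrixPowers

end

/-! ### Assembly of the complex, real and Nayak statements -/

open MatrixPowers Matrix in
theorem mainTheorem1 (n : ℕ) :
    -- complex matrices
    (∀ A C : Matrix (Fin n) (Fin n) ℂ, IsUnit C →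
      (∃ M : Matrix (Fin n) (Fin n) ℂ, IsUnit M ∧
        hyperbolicComponent A = M * toComplex (moduliMatrix A) * M⁻¹) ∧
      (∀ M : Matrix (Fin n) (Fin n) ℂ, IsUnit M →
        ∃ L Q : Matrix (Fin n) (Fin n) ℂ,
          L.IsLowerTriangular ∧ Q ∈ unitaryGroup (Fin n) ℂ ∧ M⁻¹ * C = L * Q) ∧
      ∃ X : Matrix (Fin n) (Fin n) ℂ, ∀ B M L Q : Matrix (Fin n) (Fin n) ℂ,
        IsUnit B → IsUnit M →
        hyperbolicComponent A = M * toComplex (moduliMatrix A) * M⁻¹ →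
        L.IsLowerTriangular → Q ∈ unitaryGroup (Fin n) ℂ → M⁻¹ * C = L * Q →
        Tendsto (fun m : ℕ => absRoot (B * A ^ m * C) m) atTop
            (𝓝 (Qᴴ * toComplex (moduliMatrix A) * Q)) ∧
          Qᴴ * toComplex (moduliMatrix A) * Q = X) ∧
    -- real matrices
    (∀ A C : Matrix (Fin n) (Fin n) ℝ, IsUnit C →
      (∃ M : Matrix (Fin n) (Fin n) ℝ, IsUnit M ∧
        hyperbolicComponent (toComplex A) =
          toComplex (M * moduliMatrix (toComplex A) * M⁻¹)) ∧
      (∀ M : Matrix (Fin n) (Fin n) ℝ, IsUnit M →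
        ∃ L Q : Matrix (Fin n) (Fin n) ℝ,
          L.IsLowerTriangular ∧ Q ∈ orthogonalGroup (Fin n) ℝ ∧ M⁻¹ * C = L * Q) ∧
      ∃ X : Matrix (Fin n) (Fin n) ℝ, ∀ B M L Q : Matrix (Fin n) (Fin n) ℝ,
        IsUnit B → IsUnit M →
        hyperbolicComponent (toComplex A) =
          toComplex (M * moduliMatrix (toComplex A) * M⁻¹) →
        L.IsLowerTriangular → Q ∈ orthogonalGroup (Fin n) ℝ → M⁻¹ * C = L * Q →
        Tendsto (fun m : ℕ => absRoot (B * A ^ m * C) m) atTop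
            (𝓝 (Qᵀ * moduliMatrix (toComplex A) * Q)) ∧
          Qᵀ * moduliMatrix (toComplex A) * Q = X) ∧
    -- Nayak's theorem
    (∀ A S N : Matrix (Fin n) (Fin n) ℂ,
      A = S + N → Commute S N → IsDiagonalizable S → IsNilpotent N →
      ∀ (s : ℕ) (γ : Fin s → ℝ), StrictAnti γ →
        Set.range γ = {r : ℝ | ∃ μ ∈ spectrum ℂ A, ‖μ‖ = r} →
        ((∑ j : Fin s,
            (γ j : ℂ) • (nayakProjection S γ j - nayakProjection S γ (j + 1))).PosSemidef ∧
          Tendsto (fun m : ℕ => absRoot (A ^ m) m) atTop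
            (𝓝 (∑ j : Fin s,
              (γ j : ℂ) • (nayakProjection S γ j - nayakProjection S γ (j + 1))))) ∧
        (∀ (j : Fin s) (x : EuclideanSpace ℂ (Fin n)), x ≠ 0 →
          (x ∈ imageOf (nayakProjection S γ j) \ imageOf (nayakProjection S γ (j + 1)) ↔
            Tendsto (fun m : ℕ => ‖toEuclideanCLM (𝕜 := ℂ) (A ^ m) x‖ ^ (1 / (m : ℝ))) atTop
              (𝓝 (γ j)))) ∧
        (∀ (j : Fin s) (k : ℕ),
          Set.MapsTo (toEuclideanCLM (𝕜 := ℂ) (A ^ k))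
            (imageOf (nayakProjection S γ j)) (imageOf (nayakProjection S γ j)) ∧
          (0 < γ j →
            Set.MapsTo (toEuclideanCLM (𝕜 := ℂ) (A ^ k))
              (imageOf (nayakProjection S γ j) \ imageOf (nayakProjection S γ (j + 1)))
              (imageOf (nayakProjection S γ j) \ imageOf (nayakProjection S γ (j + 1)))))) := by
  refine ⟨fun A C hC => ⟨exists_hyperbolicComponent_eq A, fun M hM =>
    exists_lowerTriangular_mul_unitary ((isUnit_nonsing_inv_iff.2 hM).mul hC), ?_⟩,
    fun A C hC => ⟨exists_real_hyperbolicComponent_eq A, fun M hM =>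
      exists_lowerTriangular_mul_unitary ((isUnit_nonsing_inv_iff.2 hM).mul hC), ?_⟩, ?_⟩
  · obtain ⟨M₀, hM₀, hH₀⟩ := exists_hyperbolicComponent_eq A
    obtain ⟨L₀, Q₀, hL₀, hQ₀, hLQ₀⟩ :=
      exists_lowerTriangular_mul_unitary ((isUnit_nonsing_inv_iff.2 hM₀).mul hC)
    refine ⟨Q₀ᴴ * toComplex (moduliMatrix A) * Q₀, fun B M L Q hB hM hH hL hQ hLQ =>
      ⟨tendsto_absRoot hB hC hM hH hL hQ hLQ, ?_⟩⟩
    -- The same sequence, with the same `B`, converges to the expressions formed from both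
    -- factorizations; the reference one does not involve `B`.
    exact tendsto_nhds_unique (tendsto_absRoot hB hC hM hH hL hQ hLQ)
      (tendsto_absRoot hB hC hM₀ hH₀ hL₀ hQ₀ hLQ₀)
  · obtain ⟨M₀, hM₀, hH₀⟩ := exists_real_hyperbolicComponent_eq A
    obtain ⟨L₀, Q₀, hL₀, hQ₀, hLQ₀⟩ :=
      exists_lowerTriangular_mul_unitary ((isUnit_nonsing_inv_iff.2 hM₀).mul hC)
    refine ⟨Q₀ᵀ * moduliMatrix (toComplex A) * Q₀, fun B M L Q hB hM hH hL hQ hLQ =>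
      ⟨tendsto_absRoot_real hB hC hM hH hL hQ hLQ, ?_⟩⟩
    exact tendsto_nhds_unique (tendsto_absRoot_real hB hC hM hH hL hQ hLQ)
      (tendsto_absRoot_real hB hC hM₀ hH₀ hL₀ hQ₀ hLQ₀)
  · intro A S N hA hSN hS hN s γ hγ hrange
    obtain ⟨κ, hκ⟩ := exists_index_of_range_eq hrange
    obtain ⟨M, hM, hH⟩ := exists_hyperbolicComponent_eq A
    obtain ⟨L, Q, hL, hQ, hMLQ⟩ :=
      exists_lowerTriangular_mul_unitary (isUnit_nonsing_inv_iff.2 hM)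
    rw [sum_nayakProjection_eq hA hSN hS hN hM hH hL hQ hMLQ hγ hκ]
    refine ⟨⟨(moduliMatrix_posSemidef A).conjTranspose_mul_mul_same Q, ?_⟩,
      fun j x hx => mem_layer_iff_tendsto hA hSN hS hN hM hH hγ hκ j hx,
      fun j k => ⟨mapsTo_imageOf_nayakProjection hA hSN hS hN hM hH hγ hκ j k,
        mapsTo_layer hA hSN hS hN hM hH hγ hκ j k⟩⟩
    have h := tendsto_absRoot (B := 1) (C := 1) isUnit_one isUnit_one hM hH hL hQ
      (by rw [mul_one, hMLQ])
    simpa only [one_mul, mul_one] using h
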